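/- A \emph{standard dyadic interval} is an interval $[k/2^m,(k+1)/2^m]$ with $k,m\in\mathbb{N}$, and a \emph{dyadic subdivision} is a partition of $[0,1]$ into finitely many standard dyadic intervals. Let $F$ be Thompson's group: the group, under composition, of all homeomorphisms of $[0,1]$ that map, for some pair of dyadic subdivisions of $[0,1]$ with the same number of intervals, each interval of the first affinely, with positive slope, onto the corresponding interval (in left-to-right order) of the second. Products are read from left to right: $(fg)(t)=g(f(t))$. Let $x_0\in F$ map the subdivision with cuts $0,\frac14,\frac12,1$ to the one with cuts $0,\frac12,\frac34,1$, and let $x_1\in F$ map the subdivision with cuts $0,\frac12,\frac58,\frac34,1$ to the one with cuts $0,\frac12,\frac34,\frac78,1$; these two elements generate $F$. Let $\Gamma$ be the Cayley graph of $F$ with respect to $\{x_0,x_1\}$ (edges join $g$ and $gs$ for $g\in F$, $s\in\{x_0,x_1\}$), with its graph distance $d$. A \emph{loop of circumference $n$} ($n\ge 3$) is \emph{isometrically embedded} in $\Gamma$ if it has vertices $\gamma_0,\dots,\gamma_{n-1}\in F$, in cyclic order, with $d(\gamma_i,\gamma_j)=\min(|i-j|,\,n-|i-j|)$ for all $i,j$.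 A \emph{combing} of $F$ is a choice, for each $g\in F$, of a path in $\Gamma$ from the identity to $g$, i.e. of a word in $x_0^{\pm1},x_1^{\pm1}$ with product $g$; it is \emph{geodesic} if each chosen word for $g$ has length $d(1,g)$. It has the \emph{fellow traveller property} if there is a $k\in\mathbb{N}$ such that for all $g,h\in F$ with $d(g,h)=1$, with chosen words $\sigma_1\cdots\sigma_\ell$ and $\tau_1\cdots\tau_m$, one has $d(\sigma_1\cdots\sigma_n,\tau_1\cdots\tau_n)\le k$ for every $n\in\mathbb{N}$, where $\sigma_i=1$ for $i>\ell$ and $\tau_i=1$ for $i>m$. Then: (1) $\Gamma$ contains isometrically embedded loops of arbitrarily large circumference: for every $N$ there is an isometrically embedded loop of some circumference $n\ge N$. (2) No geodesic combing of $F$ (with respect to $\{x_0,x_1\}$) has the fellow traveller property. -/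

import Mathlib

open scoped unitInterval

/-- `[u, v]` is a standard dyadic interval `[k / 2 ^ m, (k + 1) / 2 ^ m]`. -/
def IsStandardDyadic (u v : ℝ) : Prop :=
  ∃ k m : ℕ, u = (k : ℝ) / 2 ^ m ∧ v = ((k : ℝ) + 1) / 2 ^ m

/-- `a 0, a 1, …, a n` are the cut points of a dyadic subdivision of `[0, 1]`, i.e. of a
partition of `[0, 1]` into `n` standard dyadic intervals `[a i, a (i + 1)]`. -/
structure IsDyadicSubdivision {n : ℕ} (a : Fin (n + 1) → ℝ) : Prop where
  first : a 0 = 0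
  last : a (Fin.last n) = 1
  std : ∀ i : Fin n, IsStandardDyadic (a i.castSucc) (a i.succ)

/-- A homeomorphism of `[0, 1]` is a dyadic rearrangement if it maps, for two dyadic subdivisions
`a`, `b` with the same number of intervals, each interval of `a` affinely (with positive slope)
onto the corresponding interval of `b`. -/
def IsDyadicRearrangement (f : I ≃ₜ I) : Prop :=
  ∃ (n : ℕ) (a b : Fin (n + 1) → ℝ), IsDyadicSubdivision a ∧ IsDyadicSubdivision b ∧
    ∀ (i : Fin n) (t : I), a i.castSucc ≤ t → (t : ℝ) ≤ a i.succ →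
      (f t : ℝ) = b i.castSucc +
        (b i.succ - b i.castSucc) / (a i.succ - a i.castSucc) * (t - a i.castSucc)

theorem IsStandardDyadic.lt {u v : ℝ} (h : IsStandardDyadic u v) : u < v := by
  obtain ⟨k, m, rfl, rfl⟩ := h
  gcongr
  linarith

theorem isDyadicRearrangement_one : IsDyadicRearrangement 1 := by
  have h : IsDyadicSubdivision (n := 1) ![0, 1] :=
    ⟨by simp, by simp, fun i => ⟨0, 0, by fin_cases i; simp, by fin_cases i; simp⟩⟩
  refine ⟨1, ![0, 1], ![0, 1], h, h, fun i t _ _ => ?_⟩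
  fin_cases i
  simp

theorem IsDyadicRearrangement.symm {f : I ≃ₜ I} (hf : IsDyadicRearrangement f) :
    IsDyadicRearrangement f.symm := by
  obtain ⟨n, a, b, ha, hb, h⟩ := hf
  have aI : ∀ i : Fin (n + 1), 0 ≤ a i := by
    intro i
    refine Fin.cases ha.first.ge (fun j => ?_) i
    obtain ⟨k, m, -, h2⟩ := ha.std j
    rw [h2]; positivity
  have aI' : ∀ i : Fin (n + 1), a i ≤ 1 := by
    intro i
    refine Fin.reverseInduction ha.last.le (fun j hj => ?_) i
    exact (ha.std j).lt.le.trans hj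
  refine ⟨n, b, a, hb, ha, fun i t h1 h2 => ?_⟩
  have la := (ha.std i).lt
  have lb := (hb.std i).lt
  set s : ℝ := a i.castSucc +
        (a i.succ - a i.castSucc) / (b i.succ - b i.castSucc) * (t - b i.castSucc) with hs
  have hra : 0 < a i.succ - a i.castSucc := sub_pos.2 la
  have hrb : 0 < b i.succ - b i.castSucc := sub_pos.2 lb
  have s1 : a i.castSucc ≤ s := by
    have : 0 ≤ (a i.succ - a i.castSucc) / (b i.succ - b i.castSucc) * (t - b i.castSucc) :=
      mul_nonneg (div_pos hra hrb).le (sub_nonneg.2 h1)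
    linarith
  have s2 : s ≤ a i.succ := by
    have : (a i.succ - a i.castSucc) / (b i.succ - b i.castSucc) * (t - b i.castSucc) ≤
        a i.succ - a i.castSucc := by
      rw [div_mul_eq_mul_div, div_le_iff₀ hrb]
      exact mul_le_mul_of_nonneg_left (by linarith) hra.le
    linarith
  have key := h i ⟨s, (aI _).trans s1, s2.trans (aI' _)⟩ s1 s2
  have : f.symm t = ⟨s, (aI _).trans s1, s2.trans (aI' _)⟩ := by
    rw [Homeomorph.symm_apply_eq]
    apply Subtype.ext
    rw [key]
    change _ = _ + _ * (s - _)
    rw [hs]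
    field_simp
    ring
  rw [this]

/-- Every sufficiently fine uniform dyadic grid refines a given dyadic subdivision. -/
theorem IsDyadicSubdivision.exists_refine {n : ℕ} {a : Fin (n + 1) → ℝ}
    (ha : IsDyadicSubdivision a) : ∃ N₀ : ℕ, ∀ N ≥ N₀, ∀ j : ℕ, j < 2 ^ N →
      ∃ i : Fin n, a i.castSucc ≤ (j : ℝ) / 2 ^ N ∧ ((j : ℝ) + 1) / 2 ^ N ≤ a i.succ := by
  choose k m hk hm using ha.std
  refine ⟨Finset.univ.sup m, fun N hN j hj => ?_⟩
  have hx : (j : ℝ) / 2 ^ N < 1 := by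
    rw [div_lt_one (by positivity)]
    exact_mod_cast hj
  have hex : ∃ i : Fin n, a i.castSucc ≤ (j : ℝ) / 2 ^ N ∧ (j : ℝ) / 2 ^ N < a i.succ := by
    by_contra! hcon
    have : ∀ i : Fin (n + 1), a i ≤ (j : ℝ) / 2 ^ N := by
      intro i
      induction i using Fin.induction with
      | zero => rw [ha.first]; positivity
      | succ i ih => exact hcon i ih
    have := this (Fin.last n)
    rw [ha.last] at this
    linarith
  obtain ⟨i, h1, h2⟩ := hex
  refine ⟨i, h1, ?_⟩
  have hmN : m i ≤ N := (Finset.le_sup (f := m) (Finset.mem_univ i)).trans hN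
  obtain ⟨e, rfl⟩ := Nat.exists_eq_add_of_le hmN
  rw [hm i] at h2 ⊢
  rw [div_lt_div_iff₀ (by positivity) (by positivity), pow_add] at h2
  have h3 : (j : ℝ) < (k i + 1) * 2 ^ e := by
    have : (0 : ℝ) < 2 ^ m i := by positivity
    nlinarith
  have h4 : j + 1 ≤ (k i + 1) * 2 ^ e := by exact_mod_cast h3
  have h5 : (j : ℝ) + 1 ≤ (k i + 1) * 2 ^ e := by exact_mod_cast h4
  rw [div_le_div_iff₀ (by positivity) (by positivity), pow_add]
  have : (0 : ℝ) < 2 ^ m i := by positivity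
  nlinarith

/-- Affine maps between standard dyadic intervals preserve standard dyadic intervals. -/
theorem IsStandardDyadic.image {u v u' v' : ℝ} (h : IsStandardDyadic u v)
    (h' : IsStandardDyadic u' v') {j N : ℕ} (h1 : u ≤ (j : ℝ) / 2 ^ N)
    (h2 : ((j : ℝ) + 1) / 2 ^ N ≤ v) :
    IsStandardDyadic (u' + (v' - u') / (v - u) * ((j : ℝ) / 2 ^ N - u))
      (u' + (v' - u') / (v - u) * (((j : ℝ) + 1) / 2 ^ N - u)) := by
  obtain ⟨k, m, rfl, rfl⟩ := h
  obtain ⟨k', m', rfl, rfl⟩ := h'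
  have hmN : m ≤ N := by
    have h3 : (1 : ℝ) / 2 ^ N ≤ 1 / 2 ^ m := by
      have e1 : ((j : ℝ) + 1) / 2 ^ N - j / 2 ^ N = 1 / 2 ^ N := by ring
      have e2 : ((k : ℝ) + 1) / 2 ^ m - k / 2 ^ m = 1 / 2 ^ m := by ring
      linarith
    rw [one_div_le_one_div (by positivity) (by positivity)] at h3
    exact (pow_le_pow_iff_right₀ (by norm_num)).1 h3
  obtain ⟨e, rfl⟩ := Nat.exists_eq_add_of_le hmN
  have h3 : (k : ℝ) * 2 ^ e ≤ j := by
    rw [div_le_div_iff₀ (by positivity) (by positivity), pow_add] at h1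
    have : (0 : ℝ) < 2 ^ m := by positivity
    nlinarith
  have h4 : k * 2 ^ e ≤ j := by exact_mod_cast h3
  obtain ⟨r, rfl⟩ := Nat.exists_eq_add_of_le h4
  have e2 : ((k : ℝ) + 1) / 2 ^ m - k / 2 ^ m = 1 / 2 ^ m := by ring
  have e3 : ((k' : ℝ) + 1) / 2 ^ m' - k' / 2 ^ m' = 1 / 2 ^ m' := by ring
  refine ⟨k' * 2 ^ e + r, m' + e, ?_, ?_⟩
  · rw [e2, e3]; push_cast; rw [pow_add, pow_add]; field_simp; ring
  · rw [e2, e3]; push_cast; rw [pow_add, pow_add]; field_simp; ring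

/-- A dyadic rearrangement maps every interval of a sufficiently fine uniform dyadic grid affinely
onto a standard dyadic interval. -/
theorem IsDyadicRearrangement.exists_grid {f : I ≃ₜ I} (hf : IsDyadicRearrangement f) :
    (f 0 = 0 ∧ f 1 = 1) ∧ ∃ N₀ : ℕ, ∀ N ≥ N₀, ∀ (j : ℕ) (p q : I), (p : ℝ) = (j : ℝ) / 2 ^ N →
      (q : ℝ) = ((j : ℝ) + 1) / 2 ^ N → IsStandardDyadic (f p) (f q) ∧
        ∀ t : I, p ≤ t → t ≤ q →
          (f t : ℝ) = f p + ((f q : ℝ) - f p) / (q - p) * ((t : ℝ) - p) := by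
  obtain ⟨n, a, b, ha, hb, h⟩ := hf
  refine ⟨?_, ?_⟩
  · obtain _ | n := n
    · have h0 := ha.first
      have h1 := ha.last
      have : (Fin.last 0) = 0 := rfl
      rw [this] at h1
      linarith
    · constructor
      · apply Subtype.ext
        have l := (ha.std 0).lt
        have := h 0 0 (by simp [ha.first]) (by simpa [ha.first] using l.le)
        rw [this]
        simp [ha.first, hb.first]
      · apply Subtype.ext
        have l := (ha.std (Fin.last n)).lt
        have hl : a (Fin.last n).succ = 1 := by rw [Fin.succ_last]; exact ha.last
        have hl' : b (Fin.last n).succ = 1 := by rw [Fin.succ_last]; exact hb.last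
        have := h (Fin.last n) 1 (by rw [hl] at l; simpa using l.le) (by rw [hl]; simp)
        rw [this]
        rw [hl] at l ⊢
        rw [hl']
        have : 1 - a (Fin.last n).castSucc ≠ 0 := by linarith
        simp only [Set.Icc.coe_one]
        field_simp
        ring
  · obtain ⟨N₀, hN₀⟩ := ha.exists_refine
    refine ⟨N₀, fun N hN j p q hp hq => ?_⟩
    have hj : j < 2 ^ N := by
      have := q.2.2
      rw [hq, div_le_one (by positivity)] at this
      exact_mod_cast this
    obtain ⟨i, h1, h2⟩ := hN₀ N hN j hj
    have hpq : (p : ℝ) < q := by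
      rw [hp, hq]; gcongr; linarith
    have hfp := h i p (hp ▸ h1) (hpq.le.trans (hq ▸ h2))
    have hfq := h i q ((hp ▸ h1 : a i.castSucc ≤ p).trans hpq.le) (hq ▸ h2)
    refine ⟨?_, fun t ht1 ht2 => ?_⟩
    · rw [hfp, hfq, hp, hq]
      exact (ha.std i).image (hb.std i) h1 h2
    · have hft := h i t ((hp ▸ h1 : a i.castSucc ≤ p).trans ht1)
        (le_trans (b := (q : ℝ)) ht2 (hq ▸ h2))
      have : (q : ℝ) - p ≠ 0 := by linarith
      rw [hft, hfp, hfq]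
      field_simp
      ring

theorem IsDyadicRearrangement.trans {f g : I ≃ₜ I} (hf : IsDyadicRearrangement f)
    (hg : IsDyadicRearrangement g) : IsDyadicRearrangement (f.trans g) := by
  obtain ⟨⟨f0, f1⟩, Nf, hNf⟩ := hf.symm.exists_grid
  obtain ⟨⟨g0, g1⟩, Ng, hNg⟩ := hg.exists_grid
  set N := max Nf Ng
  have hmem : ∀ j : Fin (2 ^ N + 1), ((j : ℕ) : ℝ) / 2 ^ N ∈ I := by
    intro j
    refine ⟨by positivity, ?_⟩
    rw [div_le_one (by positivity)]
    exact_mod_cast Nat.lt_succ_iff.1 j.2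
  let P : Fin (2 ^ N + 1) → I := fun j => ⟨_, hmem j⟩
  have hP : ∀ j, (P j : ℝ) = ((j : ℕ) : ℝ) / 2 ^ N := fun j => rfl
  have P0 : P 0 = 0 := by apply Subtype.ext; simp [hP]
  have P1 : P (Fin.last _) = 1 := by apply Subtype.ext; simp [hP]
  have cS : ∀ i : Fin (2 ^ N), (P i.castSucc : ℝ) = ((i : ℕ) : ℝ) / 2 ^ N := by
    intro i; simp [hP]
  have cS' : ∀ i : Fin (2 ^ N), (P i.succ : ℝ) = (((i : ℕ) : ℝ) + 1) / 2 ^ N := by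
    intro i; simp [hP]
  have F := fun i : Fin (2 ^ N) =>
    hNf N (le_max_left _ _) i (P i.castSucc) (P i.succ) (cS i) (cS' i)
  have G := fun i : Fin (2 ^ N) =>
    hNg N (le_max_right _ _) i (P i.castSucc) (P i.succ) (cS i) (cS' i)
  refine ⟨2 ^ N, fun j => f.symm (P j), fun j => g (P j), ⟨by simp [P0, f0], by simp [P1, f1],
    fun i => (F i).1⟩, ⟨by simp [P0, g0], by simp [P1, g1], fun i => (G i).1⟩, ?_⟩
  intro i t h1 h2
  dsimp only at h1 h2 ⊢
  have lF := (F i).1.lt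
  have lP : (P i.castSucc : ℝ) < P i.succ := by rw [cS, cS']; gcongr; linarith
  have hrF : 0 < (f.symm (P i.succ) : ℝ) - f.symm (P i.castSucc) := sub_pos.2 lF
  have hrP : 0 < (P i.succ : ℝ) - P i.castSucc := sub_pos.2 lP
  set s : ℝ := P i.castSucc + ((P i.succ : ℝ) - P i.castSucc) /
    ((f.symm (P i.succ) : ℝ) - f.symm (P i.castSucc)) * (t - f.symm (P i.castSucc)) with hs
  have s1 : (P i.castSucc : ℝ) ≤ s := by
    have := mul_nonneg (div_pos hrP hrF).le (sub_nonneg.2 h1)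
    linarith
  have s2 : s ≤ P i.succ := by
    have : ((P i.succ : ℝ) - P i.castSucc) /
        ((f.symm (P i.succ) : ℝ) - f.symm (P i.castSucc)) * (t - f.symm (P i.castSucc)) ≤
        (P i.succ : ℝ) - P i.castSucc := by
      rw [div_mul_eq_mul_div, div_le_iff₀ hrF]
      exact mul_le_mul_of_nonneg_left (by linarith) hrP.le
    linarith
  let S : I := ⟨s, (P i.castSucc).2.1.trans s1, s2.trans (P i.succ).2.2⟩
  have hfS : f.symm S = t := by
    apply Subtype.ext
    rw [(F i).2 S s1 s2]
    change _ + _ * (s - _) = _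
    rw [hs]
    field_simp
    ring
  have hft : f t = S := by rw [← hfS]; simp
  have hgS := (G i).2 S s1 s2
  rw [Homeomorph.trans_apply, hft, hgS]
  change _ + _ * (s - _) = _
  rw [hs]
  field_simp
  ring

/-- Thompson's group `F`: the dyadic rearrangements of `[0, 1]` under composition. Products are
read from left to right, `(f * g) (t) = g (f t)`; this is the reason for the opposite group. -/
def ThompsonF : Subgroup (I ≃ₜ I)ᵐᵒᵖ where
  carrier := {f | IsDyadicRearrangement f.unop}
  one_mem' := isDyadicRearrangement_one
  mul_mem' hf hg := hf.trans hg
  inv_mem' hf := hf.symm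

/-- The convention on products in `ThompsonF`. -/
theorem ThompsonF.mul_apply (f g : ThompsonF) (t : I) :
    (f * g).1.unop t = g.1.unop (f.1.unop t) := rfl

/-- The underlying function of `x₀`, which maps the intervals of the subdivision with cuts
`0, 1/4, 1/2, 1` to those of the subdivision with cuts `0, 1/2, 3/4, 1`. -/
noncomputable def x0Fun (t : ℝ) : ℝ :=
  if t ≤ 1 / 4 then 2 * t else if t ≤ 1 / 2 then t + 1 / 4 else (t + 1) / 2

/-- The inverse of `x0Fun`. -/
noncomputable def x0Inv (t : ℝ) : ℝ :=
  if t ≤ 1 / 2 then t / 2 else if t ≤ 3 / 4 then t - 1 / 4 else 2 * t - 1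

/-- The underlying function of `x₁`, which maps the intervals of the subdivision with cuts
`0, 1/2, 5/8, 3/4, 1` to those of the subdivision with cuts `0, 1/2, 3/4, 7/8, 1`. -/
noncomputable def x1Fun (t : ℝ) : ℝ :=
  if t ≤ 1 / 2 then t else if t ≤ 5 / 8 then 2 * t - 1 / 2 else
    if t ≤ 3 / 4 then t + 1 / 8 else (t + 1) / 2

/-- The inverse of `x1Fun`. -/
noncomputable def x1Inv (t : ℝ) : ℝ :=
  if t ≤ 1 / 2 then t else if t ≤ 3 / 4 then (t + 1 / 2) / 2 else
    if t ≤ 7 / 8 then t - 1 / 8 else 2 * t - 1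

/-- The homeomorphism of `[0, 1]` given by `x0Fun`. -/
noncomputable def x0Homeo : I ≃ₜ I :=
  (StrictMono.orderIsoOfRightInverse
    (fun t : I => (⟨x0Fun t, by
      have := t.2.1; have := t.2.2; unfold x0Fun; constructor <;> split_ifs <;> linarith⟩ : I))
    (fun s t h => by
      have h : (s : ℝ) < t := h
      change x0Fun s < x0Fun t
      unfold x0Fun; split_ifs <;> linarith)
    (fun t : I => (⟨x0Inv t, by
      have := t.2.1; have := t.2.2; unfold x0Inv; constructor <;> split_ifs <;> linarith⟩ : I))
    (fun t => Subtype.ext (by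
      change x0Fun (x0Inv t) = t
      unfold x0Fun x0Inv; split_ifs <;> linarith))).toHomeomorph

/-- The homeomorphism of `[0, 1]` given by `x1Fun`. -/
noncomputable def x1Homeo : I ≃ₜ I :=
  (StrictMono.orderIsoOfRightInverse
    (fun t : I => (⟨x1Fun t, by
      have := t.2.1; have := t.2.2; unfold x1Fun; constructor <;> split_ifs <;> linarith⟩ : I))
    (fun s t h => by
      have h : (s : ℝ) < t := h
      change x1Fun s < x1Fun t
      unfold x1Fun; split_ifs <;> linarith)
    (fun t : I => (⟨x1Inv t, by
      have := t.2.1; have := t.2.2; unfold x1Inv; constructor <;> split_ifs <;> linarith⟩ : I))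
    (fun t => Subtype.ext (by
      change x1Fun (x1Inv t) = t
      unfold x1Fun x1Inv; split_ifs <;> linarith))).toHomeomorph

theorem coe_x0Homeo (t : I) : (x0Homeo t : ℝ) = x0Fun t := rfl

theorem coe_x1Homeo (t : I) : (x1Homeo t : ℝ) = x1Fun t := rfl

theorem isDyadicRearrangement_x0 : IsDyadicRearrangement x0Homeo := by
  refine ⟨3, ![0, 1 / 4, 1 / 2, 1], ![0, 1 / 2, 3 / 4, 1], ⟨rfl, rfl, fun i => ?_⟩,
    ⟨rfl, rfl, fun i => ?_⟩, fun i t h1 h2 => ?_⟩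
  · fin_cases i
    · exact ⟨0, 2, by norm_num, by norm_num⟩
    · exact ⟨1, 2, by norm_num, show (1 / 2 : ℝ) = _ by norm_num⟩
    · exact ⟨1, 1, by norm_num, by norm_num⟩
  · fin_cases i
    · exact ⟨0, 1, by norm_num, by norm_num⟩
    · exact ⟨2, 2, by norm_num, show (3 / 4 : ℝ) = _ by norm_num⟩
    · exact ⟨3, 2, by norm_num, by norm_num⟩
  · rw [coe_x0Homeo]
    fin_cases i <;> simp at h1 h2 ⊢ <;> unfold x0Fun <;> split_ifs <;> linarith

theorem isDyadicRearrangement_x1 : IsDyadicRearrangement x1Homeo := by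
  refine ⟨4, ![0, 1 / 2, 5 / 8, 3 / 4, 1], ![0, 1 / 2, 3 / 4, 7 / 8, 1],
    ⟨rfl, rfl, fun i => ?_⟩, ⟨rfl, rfl, fun i => ?_⟩, fun i t h1 h2 => ?_⟩
  · fin_cases i
    · exact ⟨0, 1, by norm_num, by norm_num⟩
    · exact ⟨4, 3, by norm_num, show (5 / 8 : ℝ) = _ by norm_num⟩
    · exact ⟨5, 3, by norm_num, by norm_num⟩
    · exact ⟨3, 2, by norm_num, by norm_num⟩
  · fin_cases i
    · exact ⟨0, 1, by norm_num, by norm_num⟩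
    · exact ⟨2, 2, by norm_num, show (3 / 4 : ℝ) = _ by norm_num⟩
    · exact ⟨6, 3, by norm_num, by norm_num⟩
    · exact ⟨7, 3, by norm_num, by norm_num⟩
  · rw [coe_x1Homeo]
    fin_cases i <;> simp at h1 h2 ⊢ <;> unfold x1Fun <;> split_ifs <;> linarith

/-- The generator `x₀` of Thompson's group `F`. -/
noncomputable def ThompsonF.x0 : ThompsonF := ⟨MulOpposite.op x0Homeo, isDyadicRearrangement_x0⟩

/-- The generator `x₁` of Thompson's group `F`. -/
noncomputable def ThompsonF.x1 : ThompsonF := ⟨MulOpposite.op x1Homeo, isDyadicRearrangement_x1⟩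

/-- A loop of circumference `n` in the graph `Γ`, with vertices `γ 0, …, γ (n - 1)` in cyclic
order, is isometrically embedded: distances in `Γ` between its vertices are the distances along
the loop. (In particular consecutive vertices are adjacent and the vertices are distinct, as the
cycle is connected.) -/
def IsIsometricLoop {V : Type*} (Γ : SimpleGraph V) (n : ℕ) (γ : Fin n → V) : Prop :=
  3 ≤ n ∧ ∀ i j : Fin n, Γ.dist (γ i) (γ j) = (SimpleGraph.cycleGraph n).dist i j

/-- A combing of the group `G` with respect to `S`: for each `g` a word `c g` in the letters
`S ∪ S⁻¹` that multiplies to `g`. The `n`-th vertex of the corresponding path in the Cayley graph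
from `1` to `g` is the product of the first `n` letters. -/
structure IsCombing {G : Type*} [Group G] (S : Set G) (c : G → List G) : Prop where
  letters : ∀ g, ∀ s ∈ c g, s ∈ S ∨ s⁻¹ ∈ S
  prod_eq : ∀ g, (c g).prod = g

/-- A geodesic combing: the paths are geodesic segments of the Cayley graph, i.e. the length of
the path to `g` is the distance from `1` to `g`. -/
structure IsGeodesicCombing {G : Type*} [Group G] (S : Set G) (c : G → List G) : Prop
    extends IsCombing S c where
  geodesic : ∀ g, (c g).length = (SimpleGraph.mulCayley S).dist 1 g

/-- The fellow traveller property: for some `k`, the combing paths to any two elements a distance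
one apart have synchronous distance at most `k` (a path rests at its endpoint when it is over:
`List.take n w = w` for `n ≥ w.length`). -/
def HasFellowTravellerProperty {G : Type*} [Group G] (S : Set G) (c : G → List G) : Prop :=
  ∃ k : ℕ, ∀ g h : G, (SimpleGraph.mulCayley S).dist g h = 1 →
    ∀ n : ℕ, (SimpleGraph.mulCayley S).dist ((c g).take n).prod ((c h).take n).prod ≤ k

/-! Lower bounds for word length come from a count of class changes. The orbit points `P k` of 1/2
under x₀ and the midpoints `M k` form a line along which x₀ translates, while x₁ fixes `P k` for k ≤
0, shifts it for k ≥ 1, and sends `M 0` to `P 1`. Each point has a class `cls` in {0, 1, 2},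
arranged so that each letter changes the class of exactly one point, its pivot, and by ±1. Hence the
numbers `chg` of class changes of distinct points under a word add up to at most its length
(`sum_chg_le`).

A point `P k` with k ≤ 0 whose class never changes forces the word to be linear to its left; for k ≥
1 the word is likewise affine, fixing 1, to its right (`stay_left`, `stay_right`). So a word that
fixes `P k` but moves something beyond it must carry `P k` out of its class and back: two letters
charged to `P k` (`two_le_chg_left`, `two_le_chg_right`). As for a lamplighter, changing something
far out costs two letters for each site on the way.

(1) For n ≥ 1 the elements x₀ⁿx₁x₀⁻⁽ⁿ⁺¹⁾ and x₁ have supports on opposite sides of 1/2, so they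
commute. Their commutator gives a closed path of length 2(2n + 3). Each half of it starting at one
of the first 2n + 3 vertices is geodesic by the count (`relator_window`), and by the triangle
inequality such a path is an isometric loop (`isIsometricLoop_of_antipodal`).

(2) The element f of `sameWord a a` has a lamp lit far out on each side. Words for fx₀ and fx₀⁻¹ of
length at most 4a + 2 must light the right lamp first, respectively the left one first
(`exists_prefix_right`, `exists_prefix_left`): the count leaves no room for crossing the middle
again. About halfway, the two paths are at distance at least 2a − 1, whereas both would have to stay
within k of the path to f. -/

namespace SimpleGraph

/-! ### Closed paths and isometric loops in graphs -/

variable {V : Type*} {Γ : SimpleGraph V}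

/-- Consecutive vertices of a path in the wide sense are at distance at most `1`, so that its
vertices `i` and `i + m` are at distance at most `m`. -/
theorem edist_le_of_step {δ : ℕ → V} {n : ℕ} (h : ∀ i < n, Γ.edist (δ i) (δ (i + 1)) ≤ 1)
    (i m : ℕ) (him : i + m ≤ n) : Γ.edist (δ i) (δ (i + m)) ≤ m := by
  induction m with
  | zero => simp
  | succ m ih =>
    calc Γ.edist (δ i) (δ (i + (m + 1)))
        ≤ Γ.edist (δ i) (δ (i + m)) + Γ.edist (δ (i + m)) (δ (i + m + 1)) := Γ.edist_triangle
      _ ≤ (m : ℕ∞) + 1 := add_le_add (ih (by omega)) (h _ (by omega))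
      _ = ((m + 1 : ℕ) : ℕ∞) := by push_cast; rfl

/-- Distances along a closed path of length `2 * L` with antipodal vertices at distance `L`. -/
theorem edist_eq_of_antipodal {δ : ℕ → V} {L : ℕ}
    (h : ∀ i < 2 * L, Γ.edist (δ i) (δ (i + 1)) ≤ 1) (h0 : δ (2 * L) = δ 0)
    (hL : ∀ i < L, (L : ℕ∞) ≤ Γ.edist (δ i) (δ (i + L)))
    (i m : ℕ) (him : i + m < 2 * L) :
    Γ.edist (δ i) (δ (i + m)) = (min m (2 * L - m) : ℕ) := by
  have up := edist_le_of_step h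
  have cancel : ∀ {x : ℕ∞} {a b c : ℕ}, (a : ℕ∞) ≤ x + b → a = c + b → (c : ℕ∞) ≤ x := by
    intro x a b c h1 h2
    subst h2
    push_cast at h1
    exact (ENat.add_le_add_iff_right (ENat.natCast_ne_top b)).1 h1
  have tri := fun x y z : ℕ => Γ.edist_triangle (u := δ x) (v := δ y) (w := δ z)
  rcases le_total m L with hm | hm
  · rw [min_eq_left (by omega)]
    refine le_antisymm (up i m (by omega)) ?_
    by_cases hi : i < L
    · have h1 := hL i hi
      have h2 := up (i + m) (L - m) (by omega)
      rw [show i + m + (L - m) = i + L by omega] at h2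
      exact cancel (h1.trans ((tri i (i + m) (i + L)).trans (add_le_add le_rfl h2))) (by omega)
    -- Antipodal pairs are given only with first vertex below L, so the pair used here is the one
    -- that ends at i + m and has i on its arc.
    · have h1 := hL (i + m - L) (by omega)
      rw [show i + m - L + L = i + m by omega] at h1
      have h2 := up (i + m - L) (L - m) (by omega)
      rw [show i + m - L + (L - m) = i by omega] at h2
      refine cancel (h1.trans ((tri (i + m - L) i (i + m)).trans ?_)) (b := L - m) (by omega)
      rw [add_comm]
      exact add_le_add le_rfl h2
  · rw [min_eq_right (by omega)]
    refine le_antisymm ?_ ?_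
    · have h1 := up 0 i (by omega)
      have h2 := up (i + m) (2 * L - (i + m)) (by omega)
      rw [show i + m + (2 * L - (i + m)) = 2 * L by omega, h0, edist_comm] at h2
      rw [Nat.zero_add, edist_comm] at h1
      refine (tri i 0 (i + m)).trans ((add_le_add h1 h2).trans ?_)
      rw [← Nat.cast_add, Nat.cast_le]
      omega
    · have h1 := hL i (by omega)
      have h2 := up (i + L) (m - L) (by omega)
      rw [show i + L + (m - L) = i + m by omega, edist_comm] at h2
      exact cancel (h1.trans ((tri i (i + m) (i + L)).trans (add_le_add le_rfl h2))) (by omega)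

/-- A map of graphs that does not increase distances of adjacent vertices does not increase
distances. -/
theorem edist_map_le {W : Type*} {Δ : SimpleGraph W} {γ : W → V}
    (h : ∀ u v, Δ.Adj u v → Γ.edist (γ u) (γ v) ≤ 1) (u v : W) :
    Γ.edist (γ u) (γ v) ≤ Δ.edist u v := by
  by_cases hr : Δ.Reachable u v
  · obtain ⟨p, hp⟩ := hr.exists_walk_length_eq_edist
    rw [← hp]
    clear hp hr
    induction p with
    | nil => simp
    | cons huv p ih =>
      refine Γ.edist_triangle.trans ((add_le_add (h _ _ huv) ih).trans ?_)
      rw [Walk.length_cons, add_comm]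
      push_cast
      rfl
  · rw [edist_eq_top_of_not_reachable hr]
    exact le_top

end SimpleGraph

/-- A closed path with antipodal vertices at the greatest possible distance is an isometric
loop. -/
theorem isIsometricLoop_of_antipodal {V : Type*} {Γ : SimpleGraph V} {δ : ℕ → V} {L : ℕ}
    (hL2 : 2 ≤ L) (h : ∀ i < 2 * L, Γ.edist (δ i) (δ (i + 1)) ≤ 1) (h0 : δ (2 * L) = δ 0)
    (hL : ∀ i < L, (L : ℕ∞) ≤ Γ.edist (δ i) (δ (i + L))) :
    IsIsometricLoop Γ (2 * L) (fun i => δ i) := by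
  refine ⟨by omega, ?_⟩
  have hadj : ∀ u v : Fin (2 * L), (SimpleGraph.cycleGraph (2 * L)).Adj u v →
      Γ.edist (δ u) (δ v) ≤ 1 := by
    have key : ∀ u v : Fin (2 * L), (u - v).val = 1 → Γ.edist (δ u) (δ v) ≤ 1 := by
      intro u v huv
      have hu := u.2
      have hv := v.2
      rw [Fin.sub_def] at huv
      change (2 * L - v.val + u.val) % (2 * L) = 1 at huv
      rw [SimpleGraph.edist_comm]
      by_cases hvu : v.val + 1 < 2 * L
      · have : u.val = v.val + 1 := by
          rcases lt_or_ge (2 * L - v.val + u.val) (2 * L) with h1 | h1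
          · rw [Nat.mod_eq_of_lt h1] at huv; omega
          · rw [Nat.mod_eq_sub_mod h1, Nat.mod_eq_of_lt (by omega)] at huv; omega
        rw [this]
        exact h _ hv
      · have : u.val = 0 := by
          rcases lt_or_ge (2 * L - v.val + u.val) (2 * L) with h1 | h1
          · rw [Nat.mod_eq_of_lt h1] at huv; omega
          · rw [Nat.mod_eq_sub_mod h1, Nat.mod_eq_of_lt (by omega)] at huv; omega
        rw [this, ← h0]
        have := h _ hv
        rwa [show v.val + 1 = 2 * L by omega] at this
    intro u v huv
    rcases SimpleGraph.cycleGraph_adj'.1 huv with h1 | h1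
    · exact key u v h1
    · rw [SimpleGraph.edist_comm]; exact key v u h1
  let ε : ℕ → Fin (2 * L) := fun k => ⟨k % (2 * L), Nat.mod_lt _ (by omega)⟩
  have hε : ∀ k < 2 * L, (ε k : ℕ) = k := fun k hk => Nat.mod_eq_of_lt hk
  have hCstep : ∀ i < 2 * L, (SimpleGraph.cycleGraph (2 * L)).edist (ε i) (ε (i + 1)) ≤ 1 := by
    intro i hi
    rw [SimpleGraph.edist_le_one_iff_adj_or_eq]
    left
    rw [SimpleGraph.cycleGraph_adj']
    right
    rw [Fin.sub_def]
    change (2 * L - i % (2 * L) + (i + 1) % (2 * L)) % (2 * L) = 1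
    rw [Nat.mod_eq_of_lt hi]
    rcases lt_or_ge (i + 1) (2 * L) with h1 | h1
    · rw [Nat.mod_eq_of_lt h1, show 2 * L - i + (i + 1) = 2 * L + 1 by omega,
        Nat.add_mod_left, Nat.mod_eq_of_lt (by omega)]
    · rw [show i + 1 = 2 * L by omega, Nat.mod_self, show 2 * L - i + 0 = 1 by omega,
        Nat.mod_eq_of_lt (by omega)]
  -- Distances in the cycle come from the same lemma: its antipodal lower bound is inherited from Γ,
  -- as the loop is a 1-Lipschitz map of the cycle.
  have hC := SimpleGraph.edist_eq_of_antipodal hCstep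
    (Fin.ext (by change 2 * L % (2 * L) = 0 % (2 * L); simp)) (fun i hi => by
      have h1 := SimpleGraph.edist_map_le (γ := fun i : Fin (2 * L) => δ i) hadj (ε i) (ε (i + L))
      simp only [hε i (by omega), hε (i + L) (by omega)] at h1
      exact (hL i hi).trans h1)
  have hΓ := SimpleGraph.edist_eq_of_antipodal h h0 hL
  have main : ∀ i j : Fin (2 * L), i ≤ j →
      Γ.dist (δ i) (δ j) = (SimpleGraph.cycleGraph (2 * L)).dist i j := by
    intro i j hij
    have hij' : i.val ≤ j.val := hij
    have e1 := hΓ i (j - i) (by omega)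
    have e2 := hC i (j - i) (by omega)
    rw [Nat.add_sub_cancel' hij'] at e1 e2
    have e3 : ε i = i := Fin.ext (hε _ i.2)
    have e4 : ε j = j := Fin.ext (hε _ j.2)
    rw [e3, e4] at e2
    rw [SimpleGraph.dist, SimpleGraph.dist, e1, e2]
  intro i j
  rcases le_total i j with hij | hij
  · exact main i j hij
  · rw [SimpleGraph.dist_comm, SimpleGraph.dist_comm (u := i)]
    exact main j i hij

/-! ### Words and distances in Cayley graphs -/

section Words

variable {G : Type*} [Group G] {S : Set G}

theorem mulCayley_edist_mul_le {s : G} (hs : s ∈ S ∨ s⁻¹ ∈ S) (g : G) :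
    (SimpleGraph.mulCayley S).edist g (g * s) ≤ 1 := by
  rw [SimpleGraph.edist_le_one_iff_adj_or_eq, SimpleGraph.mulCayley_adj']
  by_cases h : g = g * s
  · exact Or.inr h
  · refine Or.inl ⟨h, ?_⟩
    rcases hs with hs | hs
    · exact ⟨s, hs, Or.inl rfl⟩
    · exact ⟨s⁻¹, hs, Or.inr (by simp)⟩

theorem mulCayley_edist_prod_le (g : G) (w : List G) (hw : ∀ s ∈ w, s ∈ S ∨ s⁻¹ ∈ S) :
    (SimpleGraph.mulCayley S).edist g (g * w.prod) ≤ w.length := by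
  induction w generalizing g with
  | nil => simp
  | cons s w ih =>
    rw [List.prod_cons, ← mul_assoc]
    refine SimpleGraph.edist_triangle.trans ((add_le_add (mulCayley_edist_mul_le
      (hw s (by simp)) g) (ih (g * s) fun t ht => hw t (by simp [ht]))).trans ?_)
    rw [List.length_cons, add_comm]
    push_cast
    rfl

theorem mulCayley_exists_word {g h : G} (p : (SimpleGraph.mulCayley S).Walk g h) :
    ∃ w : List G, (∀ s ∈ w, s ∈ S ∨ s⁻¹ ∈ S) ∧ w.length = p.length ∧ g * w.prod = h := by
  induction p with
  | nil => exact ⟨[], by simp⟩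
  | cons huv p ih =>
    obtain ⟨w, h1, h2, h3⟩ := ih
    obtain ⟨-, s, hs, h4 | h4⟩ := (SimpleGraph.mulCayley_adj' _ _ _).1 huv
    · refine ⟨s :: w, ?_, by simp [h2], by rw [List.prod_cons, ← mul_assoc, h4, h3]⟩
      simpa [hs] using h1
    · refine ⟨s⁻¹ :: w, ?_, by simp [h2], ?_⟩
      · simpa [hs] using h1
      · rw [List.prod_cons, ← mul_assoc, h4, mul_inv_cancel_right, h3]

end Words

/-! ### The letters and their action on the points `P k` and `M k` -/

namespace ThompsonF

/-- The letters `x₀`, `x₀⁻¹`, `x₁`, `x₁⁻¹`. -/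
inductive Letter
  | x | X | y | Y

/-- The action of a letter on the real line (an extension of the one on the unit interval). -/
noncomputable def Letter.act : Letter → ℝ → ℝ
  | .x => x0Fun
  | .X => x0Inv
  | .y => x1Fun
  | .Y => x1Inv

/-- The inverse letter. -/
def Letter.inv : Letter → Letter
  | .x => .X
  | .X => .x
  | .y => .Y
  | .Y => .y

theorem Letter.act_inv_act (s : Letter) (t : ℝ) : s.inv.act (s.act t) = t := by
  cases s <;> simp only [Letter.inv, Letter.act, x0Fun, x0Inv, x1Fun, x1Inv] <;>
    split_ifs <;> linarith

theorem Letter.act_strictMono (s : Letter) : StrictMono s.act := by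
  intro u v h
  cases s <;> simp only [Letter.act, x0Fun, x0Inv, x1Fun, x1Inv] <;> split_ifs <;> linarith

/-- The orbit of `1 / 2` under `x₀`. -/
noncomputable def P (k : ℤ) : ℝ := if k ≤ 0 then 2 ^ (k - 1) else 1 - 2 ^ (-k - 1)

/-- The midpoints between consecutive points of the orbit of `1 / 2` under `x₀`. -/
noncomputable def M (k : ℤ) : ℝ := (P k + P (k + 1)) / 2

theorem P_zero : P 0 = 1 / 2 := by norm_num [P]

theorem P_one : P 1 = 3 / 4 := by norm_num [P]

theorem M_zero : M 0 = 5 / 8 := by norm_num [M, P_zero, P_one]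

theorem P_pos (k : ℤ) : 0 < P k := by
  unfold P
  split_ifs with h
  · positivity
  · have : (2 : ℝ) ^ (-k - 1) < 1 := zpow_lt_one_of_neg₀ (by norm_num) (by omega)
    linarith

theorem P_lt_one (k : ℤ) : P k < 1 := by
  unfold P
  split_ifs with h
  · exact zpow_lt_one_of_neg₀ (by norm_num) (by omega)
  · have : (0 : ℝ) < 2 ^ (-k - 1) := by positivity
    linarith

theorem P_le_quarter {k : ℤ} (h : k ≤ -1) : P k ≤ 1 / 4 := by
  rw [P, if_pos (by omega)]
  calc (2 : ℝ) ^ (k - 1) ≤ 2 ^ (-2 : ℤ) := zpow_le_zpow_right₀ (by norm_num) (by omega)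
    _ = 1 / 4 := by norm_num

theorem P_ge {k : ℤ} (h : 1 ≤ k) : 3 / 4 ≤ P k := by
  rw [P, if_neg (by omega)]
  have : (2 : ℝ) ^ (-k - 1) ≤ 2 ^ (-2 : ℤ) := zpow_le_zpow_right₀ (by norm_num) (by omega)
  norm_num at this ⊢
  linarith

theorem x0Fun_P (k : ℤ) : x0Fun (P k) = P (k + 1) := by
  rcases lt_trichotomy k 0 with h | rfl | h
  · have h1 := P_le_quarter (k := k) (by omega)
    rw [x0Fun, if_pos h1, P, if_pos h.le, P, if_pos (by omega), ← zpow_one_add₀ (by norm_num)]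
    congr 1
    ring
  · rw [zero_add, P_zero, P_one]
    norm_num [x0Fun]
  · have h1 := P_ge (k := k) (by omega)
    rw [x0Fun, if_neg (by linarith), if_neg (by linarith), P, if_neg (by omega), P,
      if_neg (by omega), show (-k - 1 : ℤ) = 1 + (-(k + 1) - 1) by ring,
      zpow_one_add₀ (by norm_num)]
    ring

theorem P_strictMono : StrictMono P := by
  refine strictMono_int_of_lt_succ fun k => ?_
  have h0 := P_pos k
  have h1 := P_lt_one k
  rw [← x0Fun_P, x0Fun]
  split_ifs <;> linarith

theorem P_lt_M (k : ℤ) : P k < M k := by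
  have := P_strictMono (show k < k + 1 by omega)
  unfold M
  linarith

theorem M_lt_P (k : ℤ) : M k < P (k + 1) := by
  have := P_strictMono (show k < k + 1 by omega)
  unfold M
  linarith

theorem P_ne_M (j k : ℤ) : P j ≠ M k := by
  intro h
  have h1 : k < j := P_strictMono.lt_iff_lt.1 (h ▸ P_lt_M k)
  have h2 : j < k + 1 := P_strictMono.lt_iff_lt.1 (h ▸ M_lt_P k)
  omega

theorem x0Fun_M (k : ℤ) : x0Fun (M k) = M (k + 1) := by
  have h1 := P_lt_M k
  have h2 := M_lt_P k
  have h3 : M (k + 1) = (x0Fun (P k) + x0Fun (P (k + 1))) / 2 := by rw [x0Fun_P, x0Fun_P, M]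
  rw [h3]
  rcases lt_trichotomy k (-1) with h | rfl | h
  · have h5 := P_le_quarter (k := k + 1) (by omega)
    rw [x0Fun, x0Fun, x0Fun, if_pos (by linarith), if_pos (by linarith), if_pos (by linarith), M]
    ring
  · rw [M, show (-1 + 1 : ℤ) = 0 by norm_num, P_zero, show P (-1) = 1 / 4 by norm_num [P]]
    norm_num [x0Fun]
  · have h5 : 1 / 2 ≤ P k := by rw [← P_zero]; exact P_strictMono.monotone (by omega)
    have h6 : x0Fun (P k) = (P k + 1) / 2 := by
      rw [x0Fun, if_neg (by linarith)]
      split_ifs <;> linarith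
    rw [h6, x0Fun, x0Fun, if_neg (by linarith), if_neg (by linarith), if_neg (by linarith),
      if_neg (by linarith), M]
    ring

theorem x1Fun_of_le {t : ℝ} (h : t ≤ 1 / 2) : x1Fun t = t := if_pos h

theorem x1Fun_of_ge {t : ℝ} (h : 3 / 4 ≤ t) : x1Fun t = x0Fun t := by
  unfold x1Fun x0Fun
  split_ifs <;> linarith

theorem x1Fun_P_of_nonpos {k : ℤ} (h : k ≤ 0) : x1Fun (P k) = P k :=
  x1Fun_of_le (by rw [← P_zero]; exact P_strictMono.monotone h)

theorem x1Fun_P_of_pos {k : ℤ} (h : 1 ≤ k) : x1Fun (P k) = P (k + 1) := by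
  rw [x1Fun_of_ge (P_ge h), x0Fun_P]

theorem x1Fun_M_zero : x1Fun (M 0) = P 1 := by
  rw [M_zero, P_one]
  norm_num [x1Fun]

theorem x1Fun_M_of_pos {k : ℤ} (h : 1 ≤ k) : x1Fun (M k) = M (k + 1) := by
  rw [x1Fun_of_ge ((P_ge h).trans (P_lt_M k).le), x0Fun_M]

@[simp] theorem x_act_P (k : ℤ) : Letter.x.act (P k) = P (k + 1) := x0Fun_P k

@[simp] theorem x_act_M (k : ℤ) : Letter.x.act (M k) = M (k + 1) := x0Fun_M k

theorem Letter.inv_act_eq {s : Letter} {t u : ℝ} (h : s.act t = u) : s.inv.act u = t := by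
  rw [← h, s.act_inv_act]

@[simp] theorem X_act_P (k : ℤ) : Letter.X.act (P k) = P (k - 1) :=
  Letter.inv_act_eq (s := .x) (by simp)

@[simp] theorem X_act_M (k : ℤ) : Letter.X.act (M k) = M (k - 1) :=
  Letter.inv_act_eq (s := .x) (by simp)

theorem Y_act_P_of_nonpos {k : ℤ} (h : k ≤ 0) : Letter.Y.act (P k) = P k :=
  Letter.inv_act_eq (s := .y) (x1Fun_P_of_nonpos h)

theorem Y_act_P_one : Letter.Y.act (P 1) = M 0 := Letter.inv_act_eq (s := .y) x1Fun_M_zero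

theorem Y_act_P_of_two_le {k : ℤ} (h : 2 ≤ k) : Letter.Y.act (P k) = P (k - 1) :=
  Letter.inv_act_eq (s := .y) ((x1Fun_P_of_pos (by omega)).trans (by simp))

theorem Y_act_M_of_two_le {k : ℤ} (h : 2 ≤ k) : Letter.Y.act (M k) = M (k - 1) :=
  Letter.inv_act_eq (s := .y) ((x1Fun_M_of_pos (by omega)).trans (by simp))

/-! ### Classes of points and their changes under a letter -/

open Classical in
/-- The class of a point: `0` for the points `P k` with `k ≤ 0`, `1` for those with `k ≥ 1`,
and `2` for all other points. -/
noncomputable def cls (t : ℝ) : ℤ :=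
  if ∃ k ≤ 0, t = P k then 0 else if ∃ k ≥ 1, t = P k then 1 else 2

theorem cls_P_of_nonpos {k : ℤ} (h : k ≤ 0) : cls (P k) = 0 := if_pos ⟨k, h, rfl⟩

theorem cls_P_of_pos {k : ℤ} (h : 1 ≤ k) : cls (P k) = 1 := by
  rw [cls, if_neg, if_pos ⟨k, h, rfl⟩]
  rintro ⟨j, hj, hjk⟩
  have := P_strictMono.injective hjk
  omega

theorem cls_of_forall_ne {t : ℝ} (h : ∀ k, t ≠ P k) : cls t = 2 := by
  rw [cls, if_neg, if_neg]
  · rintro ⟨k, -, hk⟩; exact h k hk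
  · rintro ⟨k, -, hk⟩; exact h k hk

theorem cls_M (k : ℤ) : cls (M k) = 2 := cls_of_forall_ne fun j => (P_ne_M j k).symm

theorem cls_eq_zero {t : ℝ} : cls t = 0 ↔ ∃ k ≤ 0, t = P k := by
  unfold cls
  split_ifs with h1 h2 <;> simp [h1]

theorem cls_eq_one {t : ℝ} : cls t = 1 ↔ ∃ k ≥ 1, t = P k := by
  refine ⟨fun h => ?_, fun ⟨k, hk, h⟩ => h ▸ cls_P_of_pos hk⟩
  unfold cls at h
  by_contra h2
  rw [if_neg h2] at h
  split_ifs at h <;> omega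

/-- The only point whose class is changed by the letter. -/
noncomputable def Letter.pivot : Letter → ℝ
  | .x => P 0
  | .X => P 1
  | .y => M 0
  | .Y => P 1

/-- The change of the class of the pivot under the letter. -/
def Letter.jump : Letter → ℤ
  | .x => 1
  | .X => -1
  | .y => -1
  | .Y => 1

theorem cls_x0Fun {t : ℝ} (ht : t ≠ P 0) : cls (x0Fun t) = cls t := by
  by_cases h : ∃ k, t = P k
  · obtain ⟨k, rfl⟩ := h
    rw [x0Fun_P]
    rcases lt_trichotomy k 0 with h | h | h
    · rw [cls_P_of_nonpos (by omega), cls_P_of_nonpos (by omega)]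
    · exact absurd (congrArg P h) ht
    · rw [cls_P_of_pos (by omega), cls_P_of_pos (by omega)]
  · push Not at h
    rw [cls_of_forall_ne h, cls_of_forall_ne]
    intro k hk
    refine h (k - 1) (Letter.x.act_strictMono.injective ?_)
    rw [x_act_P, sub_add_cancel]
    exact hk

theorem cls_x1Fun {t : ℝ} (ht : t ≠ M 0) : cls (x1Fun t) = cls t := by
  by_cases h : ∃ k, t = P k
  · obtain ⟨k, rfl⟩ := h
    rcases le_or_gt k 0 with h | h
    · rw [x1Fun_P_of_nonpos h]
    · rw [x1Fun_P_of_pos (by omega), cls_P_of_pos (by omega), cls_P_of_pos (by omega)]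
  · push Not at h
    rw [cls_of_forall_ne h, cls_of_forall_ne]
    intro k hk
    have inj : ∀ {u}, x1Fun t = x1Fun u → t = u := fun h => Letter.y.act_strictMono.injective h
    rcases lt_trichotomy k 1 with h1 | rfl | h1
    · exact h k (inj (hk.trans (x1Fun_P_of_nonpos (by omega)).symm))
    · exact ht (inj (hk.trans x1Fun_M_zero.symm))
    · refine h (k - 1) (inj (hk.trans ?_))
      rw [x1Fun_P_of_pos (by omega), sub_add_cancel]

theorem Letter.act_pivot (s : Letter) : s.act s.pivot = s.inv.pivot := by
  cases s
  · exact x0Fun_P 0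
  · exact X_act_P 1
  · exact x1Fun_M_zero
  · exact Y_act_P_one

theorem Letter.inv_inv (s : Letter) : s.inv.inv = s := by cases s <;> rfl

theorem Letter.act_act_inv (s : Letter) (t : ℝ) : s.act (s.inv.act t) = t := by
  have := s.inv.act_inv_act t
  rwa [s.inv_inv] at this

/-- An inverse letter undoes the change made by the letter, and its pivot is the image of the
letter's pivot, so the generators x₀ and x₁ suffice. -/
theorem cls_act_of_ne {s : Letter} {t : ℝ} (h : t ≠ s.pivot) : cls (s.act t) = cls t := by
  have inv : ∀ s : Letter, (∀ {t}, t ≠ s.pivot → cls (s.act t) = cls t) → t ≠ s.inv.pivot →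
      cls (s.inv.act t) = cls t := by
    intro s hs ht
    have h1 : s.inv.act t ≠ s.pivot := fun h1 => ht (by
      rw [← s.act_act_inv t, h1, s.act_pivot])
    rw [← hs h1, s.act_act_inv]
  cases s with
  | x => exact cls_x0Fun h
  | X => exact inv .x cls_x0Fun h
  | y => exact cls_x1Fun h
  | Y => exact inv .y cls_x1Fun h

theorem cls_act_pivot (s : Letter) : cls (s.act s.pivot) = cls s.pivot + s.jump := by
  have h0 := cls_P_of_nonpos le_rfl
  have h1 := cls_P_of_pos le_rfl
  have h2 := cls_M 0
  rw [s.act_pivot]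
  cases s <;> simp only [Letter.inv, Letter.pivot, Letter.jump, h0, h1, h2] <;> rfl

/-! ### Words and the count of class changes -/

/-- The action of a word on the real line. -/
noncomputable def run : List Letter → ℝ → ℝ
  | [], t => t
  | s :: w, t => run w (s.act t)

@[simp] theorem run_nil (t : ℝ) : run [] t = t := rfl

@[simp] theorem run_cons (s : Letter) (w : List Letter) (t : ℝ) :
    run (s :: w) t = run w (s.act t) := rfl

@[simp] theorem run_append (v w : List Letter) (t : ℝ) : run (v ++ w) t = run w (run v t) := by
  induction v generalizing t with
  | nil => rfl
  | cons s v ih => exact ih _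

theorem run_strictMono (w : List Letter) : StrictMono (run w) := by
  induction w with
  | nil => exact strictMono_id
  | cons s w ih => exact ih.comp s.act_strictMono

@[simp] theorem run_replicate_x_P (n : ℕ) (k : ℤ) :
    run (List.replicate n .x) (P k) = P (k + n) := by
  induction n generalizing k with
  | zero => simp
  | succ n ih => rw [List.replicate_succ, run_cons, x_act_P, ih]; push_cast; congr 1; ring

@[simp] theorem run_replicate_x_M (n : ℕ) (k : ℤ) :
    run (List.replicate n .x) (M k) = M (k + n) := by
  induction n generalizing k with
  | zero => simp
  | succ n ih => rw [List.replicate_succ, run_cons, x_act_M, ih]; push_cast; congr 1; ring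

@[simp] theorem run_replicate_X_P (n : ℕ) (k : ℤ) :
    run (List.replicate n .X) (P k) = P (k - n) := by
  induction n generalizing k with
  | zero => simp
  | succ n ih => rw [List.replicate_succ, run_cons, X_act_P, ih]; push_cast; congr 1; ring

@[simp] theorem run_replicate_X_M (n : ℕ) (k : ℤ) :
    run (List.replicate n .X) (M k) = M (k - n) := by
  induction n generalizing k with
  | zero => simp
  | succ n ih => rw [List.replicate_succ, run_cons, X_act_M, ih]; push_cast; congr 1; ring

/-- The number of letters of a word at which the track of a point changes its class. -/
noncomputable def chg : List Letter → ℝ → ℕ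
  | [], _ => 0
  | s :: w, t => (if t = s.pivot then 1 else 0) + chg w (s.act t)

@[simp] theorem chg_nil (t : ℝ) : chg [] t = 0 := rfl

theorem chg_cons (s : Letter) (w : List Letter) (t : ℝ) :
    chg (s :: w) t = (if t = s.pivot then 1 else 0) + chg w (s.act t) := rfl

theorem chg_append (v w : List Letter) (t : ℝ) : chg (v ++ w) t = chg v t + chg w (run v t) := by
  induction v generalizing t with
  | nil => simp
  | cons s v ih => rw [List.cons_append, chg_cons, chg_cons, ih, run_cons, add_assoc]

theorem chg_cons_eq_zero {s : Letter} {w : List Letter} {t : ℝ} :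
    chg (s :: w) t = 0 ↔ t ≠ s.pivot ∧ chg w (s.act t) = 0 := by
  rw [chg_cons]
  split_ifs with h <;> simp [h]

/-- Every letter changes the class of one point only. -/
theorem sum_chg_le {ι : Type*} (w : List Letter) (T : Finset ι) {f : ι → ℝ}
    (hf : Function.Injective f) : ∑ i ∈ T, chg w (f i) ≤ w.length := by
  classical
  induction w generalizing f with
  | nil => simp
  | cons s w ih =>
    have h1 := ih (f := fun i => s.act (f i)) (s.act_strictMono.injective.comp hf)
    have h2 : ∑ i ∈ T, (if f i = s.pivot then 1 else 0) ≤ 1 := by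
      rw [← Finset.card_filter, Finset.card_le_one]
      intro i hi j hj
      rw [Finset.mem_filter] at hi hj
      exact hf (hi.2.trans hj.2.symm)
    have h3 : ∑ i ∈ T, chg (s :: w) (f i) =
        ∑ i ∈ T, (if f i = s.pivot then 1 else 0) + ∑ i ∈ T, chg w (s.act (f i)) := by
      rw [← Finset.sum_add_distrib]
      exact Finset.sum_congr rfl fun i _ => by rw [chg_cons]
    rw [h3, List.length_cons]
    omega

/-- Every change is by ±1, so the net change is bounded by the number of changes and has the same
parity. -/
theorem cls_run (w : List Letter) (t : ℝ) :
    ∃ e : ℤ, cls (run w t) - cls t = e ∧ |e| ≤ chg w t ∧ Even (e - chg w t) := by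
  induction w generalizing t with
  | nil => exact ⟨0, by simp⟩
  | cons s w ih =>
    obtain ⟨e, h1, h2, h3⟩ := ih (s.act t)
    rw [chg_cons, run_cons]
    by_cases h : t = s.pivot
    · have h4 : cls (s.act t) = cls t + s.jump := by rw [h]; exact cls_act_pivot s
      rw [if_pos h]
      refine ⟨e + s.jump, by rw [← h1, h4]; ring, ?_, ?_⟩
      · rw [abs_le] at h2 ⊢
        push_cast
        cases s <;> simp only [Letter.jump] <;> omega
      · push_cast
        rw [Int.even_iff] at h3 ⊢
        cases s <;> simp only [Letter.jump] <;> omega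
    · rw [if_neg h, zero_add]
      exact ⟨e, by rw [← h1, cls_act_of_ne h], h2, h3⟩

theorem abs_cls_sub_le_chg (w : List Letter) (t : ℝ) : |cls (run w t) - cls t| ≤ chg w t := by
  obtain ⟨e, h1, h2, -⟩ := cls_run w t
  rwa [h1]

theorem cls_run_of_chg_eq_zero {w : List Letter} {t : ℝ} (h : chg w t = 0) :
    cls (run w t) = cls t := by
  have := abs_cls_sub_le_chg w t
  rw [h, Nat.cast_zero, abs_nonpos_iff, sub_eq_zero] at this
  exact this

/-- A class that is left has to be regained: the number of changes is even. -/
theorem two_le_chg_of_ne_zero {w : List Letter} {t : ℝ} (h : cls (run w t) = cls t)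
    (h0 : chg w t ≠ 0) : 2 ≤ chg w t := by
  obtain ⟨e, h1, -, h3⟩ := cls_run w t
  rw [h, sub_self] at h1
  rw [← h1, Int.even_iff] at h3
  omega

/-! ### Rigidity beyond a point of constant class -/

/-- To the left of a point whose class stays `0`, a word acts linearly and changes no class. -/
theorem stay_left {w : List Letter} {k : ℤ} (hk : k ≤ 0) (h : chg w (P k) = 0) {t : ℝ}
    (ht : t ≤ P k) : run w t * P k = run w (P k) * t ∧ chg w t = 0 := by
  induction w generalizing k t with
  | nil => exact ⟨by simp [mul_comm], rfl⟩
  | cons s w ih =>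
    obtain ⟨h1, h2⟩ := chg_cons_eq_zero.1 h
    have hkh : P k ≤ 1 / 2 := by rw [← P_zero]; exact P_strictMono.monotone hk
    -- Up to 1/2 every letter is linear except x₀, which breaks at 1/4; but `P 0` is its pivot, so k
    -- ≤ -1 in that case.
    have aux : ∃ c : ℝ, s.act (P k) = c * P k ∧ s.act t = c * t := by
      cases s with
      | x =>
        have hk' : P k ≤ 1 / 4 := P_le_quarter (by
          rcases hk.lt_or_eq with h | rfl
          · omega
          · exact absurd rfl h1)
        exact ⟨2, if_pos hk', if_pos (ht.trans hk')⟩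
      | X =>
        refine ⟨1 / 2, ?_, ?_⟩ <;> simp only [Letter.act, x0Inv] <;> rw [if_pos (by linarith)] <;>
          ring
      | y =>
        refine ⟨1, ?_, ?_⟩ <;> simp only [Letter.act, x1Fun] <;> rw [if_pos (by linarith)] <;> ring
      | Y =>
        refine ⟨1, ?_, ?_⟩ <;> simp only [Letter.act, x1Inv] <;> rw [if_pos (by linarith)] <;> ring
    obtain ⟨c, hc1, hc2⟩ := aux
    have h3 := cls_act_of_ne h1
    rw [cls_P_of_nonpos hk, cls_eq_zero] at h3
    obtain ⟨j, hj, hj'⟩ := h3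
    have ht' : s.act t ≤ P j := hj' ▸ s.act_strictMono.monotone ht
    obtain ⟨h4, h5⟩ := ih hj (hj' ▸ h2) ht'
    have hc : c ≠ 0 := by
      rintro rfl
      have := P_pos j
      rw [← hj', hc1, zero_mul] at this
      exact lt_irrefl _ this
    refine ⟨?_, chg_cons_eq_zero.2 ⟨?_, h5⟩⟩
    · rw [← hj', hc2] at h4
      refine mul_left_cancel₀ hc ?_
      rw [run_cons, run_cons, hc2]
      rw [hc1] at h4 ⊢
      linear_combination h4
    · rcases ht.lt_or_eq with h | rfl
      · refine ne_of_lt (h.trans_le ?_)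
        have := M_zero
        have := P_zero
        have := P_one
        cases s <;> simp only [Letter.pivot] <;> linarith
      · exact h1

/-- To the right of a point whose class stays `1`, a word acts affinely, fixing `1`, and changes
no class. -/
theorem stay_right {w : List Letter} {k : ℤ} (hk : 1 ≤ k) (h : chg w (P k) = 0) {t : ℝ}
    (ht : P k ≤ t) :
    (1 - run w t) * (1 - P k) = (1 - run w (P k)) * (1 - t) ∧ chg w t = 0 := by
  induction w generalizing k t with
  | nil => exact ⟨by simp [mul_comm], rfl⟩
  | cons s w ih =>
    obtain ⟨h1, h2⟩ := chg_cons_eq_zero.1 h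
    have hkh := P_ge hk
    -- For the inverse letters the pivot is `P 1`; a non-pivot is at least `P 2` = 7/8, beyond all
    -- their breaks.
    have hk2 : P k ≠ P 1 → 7 / 8 ≤ P k := by
      intro h
      have : 2 ≤ k := by
        rcases hk.lt_or_eq with h' | rfl
        · omega
        · exact absurd rfl h
      have h3 := P_strictMono.monotone this
      have h4 : P 2 = 7 / 8 := by norm_num [P]
      linarith
    have aux : ∃ c : ℝ, 1 - s.act (P k) = c * (1 - P k) ∧ 1 - s.act t = c * (1 - t) := by
      cases s with
      | x =>
        refine ⟨1 / 2, ?_, ?_⟩ <;> simp only [Letter.act, x0Fun] <;>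
          rw [if_neg (by linarith), if_neg (by linarith)] <;> ring
      | X =>
        have := hk2 h1
        refine ⟨2, ?_, ?_⟩ <;> simp only [Letter.act, x0Inv] <;>
          rw [if_neg (by linarith), if_neg (by linarith)] <;> ring
      | y =>
        refine ⟨1 / 2, ?_, ?_⟩ <;> simp only [Letter.act, x1Fun] <;>
          split_ifs <;> linarith
      | Y =>
        have := hk2 h1
        refine ⟨2, ?_, ?_⟩ <;> simp only [Letter.act, x1Inv] <;>
          split_ifs <;> linarith
    obtain ⟨c, hc1, hc2⟩ := aux
    have h3 := cls_act_of_ne h1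
    rw [cls_P_of_pos hk, cls_eq_one] at h3
    obtain ⟨j, hj, hj'⟩ := h3
    have ht' : P j ≤ s.act t := hj' ▸ s.act_strictMono.monotone ht
    obtain ⟨h4, h5⟩ := ih hj (hj' ▸ h2) ht'
    have hc : c ≠ 0 := by
      rintro rfl
      have := P_lt_one j
      rw [← hj'] at this
      linarith
    refine ⟨?_, chg_cons_eq_zero.2 ⟨?_, h5⟩⟩
    · rw [← hj', hc2, hc1] at h4
      refine mul_left_cancel₀ hc ?_
      rw [run_cons, run_cons]
      linear_combination h4
    · rcases ht.lt_or_eq with h | rfl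
      · refine ne_of_gt (lt_of_le_of_lt ?_ h)
        have := M_zero
        have := P_zero
        have := P_one
        cases s <;> simp only [Letter.pivot] <;> linarith
      · exact h1

theorem run_eq_run_left {w v : List Letter} {k : ℤ} (hk : k ≤ 0) (hw : chg w (P k) = 0)
    (hv : chg v (P k) = 0) (h : run w (P k) = run v (P k)) {t : ℝ} (ht : t ≤ P k) :
    run w t = run v t := by
  have h1 := (stay_left hk hw ht).1
  have h2 := (stay_left hk hv ht).1
  rw [h, ← h2] at h1
  exact mul_right_cancel₀ (P_pos k).ne' h1

theorem run_eq_run_right {w v : List Letter} {k : ℤ} (hk : 1 ≤ k) (hw : chg w (P k) = 0)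
    (hv : chg v (P k) = 0) (h : run w (P k) = run v (P k)) {t : ℝ} (ht : P k ≤ t) :
    run w t = run v t := by
  have h1 := (stay_right hk hw ht).1
  have h2 := (stay_right hk hv ht).1
  rw [h, ← h2] at h1
  have := mul_right_cancel₀ (sub_pos.2 (P_lt_one k)).ne' h1
  linarith

/-- If a word agrees at `P k`, but not further to the left, with a word that does not change the
class of `P k`, then it changes the class of `P k` at least twice. -/
theorem two_le_chg_left {w v : List Letter} {k : ℤ} (hk : k ≤ 0) (hv : chg v (P k) = 0)
    (h : run w (P k) = run v (P k)) {t : ℝ} (ht : t ≤ P k) (hne : run w t ≠ run v t) :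
    2 ≤ chg w (P k) :=
  two_le_chg_of_ne_zero (h ▸ cls_run_of_chg_eq_zero hv)
    fun h0 => hne (run_eq_run_left hk h0 hv h ht)

/-- If a word agrees at `P k`, but not further to the right, with a word that does not change the
class of `P k`, then it changes the class of `P k` at least twice. -/
theorem two_le_chg_right {w v : List Letter} {k : ℤ} (hk : 1 ≤ k) (hv : chg v (P k) = 0)
    (h : run w (P k) = run v (P k)) {t : ℝ} (ht : P k ≤ t) (hne : run w t ≠ run v t) :
    2 ≤ chg w (P k) :=
  two_le_chg_of_ne_zero (h ▸ cls_run_of_chg_eq_zero hv)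
    fun h0 => hne (run_eq_run_right hk h0 hv h ht)

/-! ### Length bounds from class changes -/

theorem le_length_of_chg {w : List Letter} {f : ℤ → ℝ} (hf : Function.Injective f) {l u : ℤ}
    (hlu : l ≤ u) (h2 : ∀ k, l ≤ k → k < u → 2 ≤ chg w (f k)) (h1 : 1 ≤ chg w (f u)) :
    2 * (u - l) + 1 ≤ w.length := by
  have h := sum_chg_le w (Finset.Icc l u) hf
  rw [← Finset.Ico_insert_right hlu, Finset.sum_insert (by simp)] at h
  have h3 := Finset.card_nsmul_le_sum (Finset.Ico l u) (fun k => chg w (f k)) 2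
    (fun k hk => h2 k (Finset.mem_Ico.1 hk).1 (Finset.mem_Ico.1 hk).2)
  rw [Int.card_Ico, smul_eq_mul] at h3
  have h4 : ((u - l).toNat : ℤ) = u - l := Int.toNat_of_nonneg (by omega)
  omega

/-- Isolates the only letter that changes the class, so that the rigidity lemmas apply to the words
before and after it. -/
theorem exists_split {w : List Letter} {t : ℝ} (h : chg w t = 1) :
    ∃ (v : List Letter) (s : Letter) (v' : List Letter), w = v ++ s :: v' ∧ chg v t = 0 ∧
      run v t = s.pivot ∧ chg v' (s.act s.pivot) = 0 := by
  induction w generalizing t with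
  | nil => simp at h
  | cons s w ih =>
    rw [chg_cons] at h
    by_cases hs : t = s.pivot
    · subst hs
      rw [if_pos rfl] at h
      have h0 : chg w (s.act s.pivot) = 0 := by omega
      exact ⟨[], s, w, rfl, rfl, rfl, h0⟩
    · rw [if_neg hs, zero_add] at h
      obtain ⟨v, s', v', rfl, h1, h2, h3⟩ := ih h
      exact ⟨s :: v, s', v', rfl, chg_cons_eq_zero.2 ⟨hs, h1⟩, h2, h3⟩

theorem two_mul_le_length {w : List Letter} {f : ℤ → ℝ} (hf : Function.Injective f) {l u : ℤ}
    (h2 : ∀ k, l ≤ k → k < u → 2 ≤ chg w (f k)) : 2 * (u - l) ≤ w.length := by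
  have h := sum_chg_le w (Finset.Ico l u) hf
  have h3 := Finset.card_nsmul_le_sum (Finset.Ico l u) (fun k => chg w (f k)) 2
    (fun k hk => h2 k (Finset.mem_Ico.1 hk).1 (Finset.mem_Ico.1 hk).2)
  rw [Int.card_Ico, smul_eq_mul] at h3
  have h4 := Int.self_le_toNat (u - l)
  omega

theorem P_injective : Function.Injective P := P_strictMono.injective

theorem one_le_chg_of_cls {w : List Letter} {t : ℝ} (h : cls (run w t) ≠ cls t) :
    1 ≤ chg w t :=
  Nat.one_le_iff_ne_zero.2 fun h0 => h (cls_run_of_chg_eq_zero h0)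

/-- Each of `P 1`, …, `P n` is fixed although `P (n + 1)` beyond it moves, which costs two letters;
`P (n + 1)` itself passes from class 1 to class 2. -/
theorem length_ge_of_fix_right {w : List Letter} {n : ℤ} (hn : 0 ≤ n)
    (hfix : ∀ k, 1 ≤ k → k ≤ n → run w (P k) = P k) (hend : run w (P (n + 1)) = M n) :
    2 * n + 1 ≤ w.length := by
  have h := le_length_of_chg (w := w) P_injective (l := 1) (u := n + 1) (by omega) ?_ ?_
  · omega
  · intro k h1 h2
    refine two_le_chg_right (v := []) h1 rfl (hfix k h1 (by omega))
      (P_strictMono.monotone h2.le) ?_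
    rw [hend]
    exact (P_ne_M _ _).symm
  · refine one_le_chg_of_cls ?_
    rw [hend, cls_M, cls_P_of_pos (by omega)]
    norm_num

/-- The two-sided count: q contributes 2, the a + b fixed points contribute 2 each and `P (b + 1)`
contributes 1. The motion of q makes the fixed points with k ≤ 0 costly, that of `P (b + 1)` those
with k ≥ 1. -/
theorem length_ge_of_fix {w : List Letter} {a b : ℤ} (ha : 0 ≤ a) (hb : 0 ≤ b) {q : ℝ}
    (hq : q < P (-a + 1)) (hqP : ∀ k, k ≠ -a → P k ≠ q) (hc : 2 ≤ chg w q) (hm : run w q ≠ q)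
    (hfix : ∀ k, -a < k → k ≤ b → run w (P k) = P k) (hend : run w (P (b + 1)) = M b) :
    2 * (a + b) + 3 ≤ w.length := by
  -- The point q takes the slot -a in the sequence of points counted; it may be `P (-a)` itself or a
  -- midpoint.
  have hf : Function.Injective (Function.update P (-a) q) := by
    intro i j hij
    by_cases hi : i = -a <;> by_cases hj : j = -a
    · rw [hi, hj]
    · rw [hi, Function.update_self, Function.update_of_ne hj] at hij
      exact absurd hij.symm (hqP j hj)
    · rw [hj, Function.update_self, Function.update_of_ne hi] at hij
      exact absurd hij (hqP i hi)
    · rw [Function.update_of_ne hi, Function.update_of_ne hj] at hij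
      exact P_injective hij
  have h := le_length_of_chg (w := w) hf (l := -a) (u := b + 1) (by omega) ?_ ?_
  · omega
  · intro k h1 h2
    rcases h1.eq_or_lt with rfl | h1
    · rwa [Function.update_self]
    · rw [Function.update_of_ne (by omega)]
      have h3 := hfix k h1 (by omega)
      rcases le_or_gt k 0 with h0 | h0
      · exact two_le_chg_left (v := []) h0 rfl h3
          (hq.le.trans (P_strictMono.monotone (by omega))) hm
      · refine two_le_chg_right (v := []) h0 rfl h3 (P_strictMono.monotone h2.le) ?_
        rw [hend]
        exact (P_ne_M _ _).symm
  · rw [Function.update_of_ne (by omega)]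
    refine one_le_chg_of_cls ?_
    rw [hend, cls_M, cls_P_of_pos (by omega)]
    norm_num

/-! ### The words along half of the loop and their minimal length -/

/-- The word `x₀ ^ a x₁ x₀ ^ -(a + b + 1) x₁⁻¹ x₀ ^ b`. -/
def oppositeWord (a b : ℕ) : List Letter :=
  List.replicate a .x ++ [.y] ++ List.replicate (a + b + 1) .X ++ [.Y] ++ List.replicate b .x

/-- The word `x₀ ^ -a x₁⁻¹ x₀ ^ (a + b + 1) x₁⁻¹ x₀ ^ -b`. -/
def sameWord (a b : ℕ) : List Letter :=
  List.replicate a .X ++ [.Y] ++ List.replicate (a + b + 1) .x ++ [.Y] ++ List.replicate b .X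

/-- The word `x₀ ^ -n x₁⁻¹ x₀ ^ n`. -/
def lampWord (n : ℕ) : List Letter :=
  List.replicate n .X ++ [.Y] ++ List.replicate n .x

theorem y_act_M_zero : Letter.y.act (M 0) = P 1 := x1Fun_M_zero

theorem y_act_P_of_pos {k : ℤ} (h : 1 ≤ k) : Letter.y.act (P k) = P (k + 1) := x1Fun_P_of_pos h

theorem run_oppositeWord_left (a b : ℕ) : run (oppositeWord a b) (M (-a)) = P (-a) := by
  simp only [oppositeWord, run_append, run_replicate_x_M, run_cons, run_nil]
  rw [neg_add_cancel, y_act_M_zero, run_replicate_X_P, Y_act_P_of_nonpos (by push_cast; omega),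
    run_replicate_x_P]
  congr 1
  push_cast
  ring

theorem run_oppositeWord_fix {a b : ℕ} {k : ℤ} (h1 : -a < k) (h2 : k ≤ b) :
    run (oppositeWord a b) (P k) = P k := by
  simp only [oppositeWord, run_append, run_replicate_x_P, run_cons, run_nil]
  rw [y_act_P_of_pos (by omega), run_replicate_X_P, Y_act_P_of_nonpos (by push_cast; omega),
    run_replicate_x_P]
  congr 1
  push_cast
  ring

theorem run_oppositeWord_right (a b : ℕ) : run (oppositeWord a b) (P (b + 1)) = M b := by
  simp only [oppositeWord, run_append, run_replicate_x_P, run_cons, run_nil]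
  rw [y_act_P_of_pos (by omega), run_replicate_X_P,
    show (b + 1 + a + 1 - (a + b + 1 : ℕ) : ℤ) = 1 by push_cast; ring, Y_act_P_one,
    run_replicate_x_M, zero_add]

theorem run_sameWord_left (a b : ℕ) : run (sameWord a b) (P (-b)) = M (-b) := by
  simp only [sameWord, run_append, run_replicate_X_P, run_cons, run_nil]
  rw [Y_act_P_of_nonpos (by omega), run_replicate_x_P,
    show (-b - a + (a + b + 1 : ℕ) : ℤ) = 1 by push_cast; ring, Y_act_P_one, run_replicate_X_M,
    zero_sub]

theorem run_sameWord_fix {a b : ℕ} {k : ℤ} (h1 : -b < k) (h2 : k ≤ a) :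
    run (sameWord a b) (P k) = P k := by
  simp only [sameWord, run_append, run_replicate_X_P, run_cons, run_nil]
  rw [Y_act_P_of_nonpos (by omega), run_replicate_x_P, Y_act_P_of_two_le (by push_cast; omega),
    run_replicate_X_P]
  congr 1
  push_cast
  ring

theorem run_sameWord_right {a b : ℕ} (h : 1 ≤ a + b) :
    run (sameWord a b) (P (a + 1)) = M a := by
  simp only [sameWord, run_append, run_replicate_X_P, run_cons, run_nil]
  rw [show (a + 1 - a : ℤ) = 1 by ring, Y_act_P_one, run_replicate_x_M,
    Y_act_M_of_two_le (by push_cast; omega), run_replicate_X_M]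
  congr 1
  push_cast
  ring

theorem run_lampWord_fix {n : ℕ} {k : ℤ} (h : k ≤ n) : run (lampWord n) (P k) = P k := by
  simp only [lampWord, run_append, run_replicate_X_P, run_cons, run_nil]
  rw [Y_act_P_of_nonpos (by omega), run_replicate_x_P, sub_add_cancel]

theorem run_lampWord_right (n : ℕ) : run (lampWord n) (P (n + 1)) = M n := by
  simp only [lampWord, run_append, run_replicate_X_P, run_cons, run_nil]
  rw [show (n + 1 - n : ℤ) = 1 by ring, Y_act_P_one, run_replicate_x_M, zero_add]

/-- A word that agrees with the given one at the points `P k` and `M k`. -/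
def AgreesWith (w z : List Letter) : Prop :=
  ∀ k, run w (P k) = run z (P k) ∧ run w (M k) = run z (M k)

/-- The additional point is `M (-a)`, which goes to `P (-a)`: from class 2 to class 0. -/
theorem AgreesWith.length_ge_oppositeWord {w : List Letter} {a b : ℕ}
    (h : AgreesWith w (oppositeWord a b)) : 2 * (a + b) + 3 ≤ w.length := by
  have hl := (h (-a)).2.trans (run_oppositeWord_left a b)
  have := length_ge_of_fix (w := w) (a := a) (b := b) (by omega) (by omega) (M_lt_P (-a))
    (fun k _ => P_ne_M _ _) ?_ ?_ (fun k h1 h2 => (h k).1.trans (run_oppositeWord_fix h1 h2))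
    ((h _).1.trans (run_oppositeWord_right a b))
  · omega
  · have h1 := abs_cls_sub_le_chg w (M (-a))
    rw [hl, cls_M, cls_P_of_nonpos (by omega)] at h1
    norm_num at h1
    exact_mod_cast h1
  · rw [hl]
    exact P_ne_M _ _

/-- Here the leftmost point counted is `P (-b)`, which goes to `M (-b)`: from class 0 to class 2. -/
theorem AgreesWith.length_ge_sameWord {w : List Letter} {a b : ℕ} (hab : 1 ≤ a + b)
    (h : AgreesWith w (sameWord a b)) : 2 * (a + b) + 3 ≤ w.length := by
  have hl := (h (-b)).1.trans (run_sameWord_left a b)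
  have := length_ge_of_fix (w := w) (a := b) (b := a) (by omega) (by omega)
    (P_strictMono (show (-b : ℤ) < -b + 1 by omega))
    (fun k hk => P_injective.ne hk) ?_ ?_ (fun k h1 h2 => (h k).1.trans (run_sameWord_fix h1 h2))
    ((h _).1.trans (run_sameWord_right hab))
  · omega
  · have h1 := abs_cls_sub_le_chg w (P (-b))
    rw [hl, cls_M, cls_P_of_nonpos (by omega)] at h1
    norm_num at h1
    exact_mod_cast h1
  · rw [hl]
    exact (P_ne_M _ _).symm

theorem AgreesWith.length_ge_lampWord {w : List Letter} {n : ℕ} (h : AgreesWith w (lampWord n)) :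
    2 * n + 1 ≤ w.length := by
  have := length_ge_of_fix_right (w := w) (n := n) (by omega)
    (fun k h1 h2 => (h k).1.trans (run_lampWord_fix h2)) ((h _).1.trans (run_lampWord_right n))
  omega

theorem chg_singleton_eq_zero {s : Letter} {t : ℝ} (h : t ≠ s.pivot) : chg [s] t = 0 :=
  chg_cons_eq_zero.2 ⟨h, rfl⟩

/-! ### The order in which short words light two lamps -/

/-- A short word for an element that lights two lamps and ends a step to the left of the middle
lights the right lamp first. -/
theorem exists_prefix_right {w : List Letter} {a b : ℤ} (ha : 0 ≤ a) (hb : 1 ≤ b)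
    (hlen : (w.length : ℤ) ≤ 2 * (a + b) + 2)
    (hfix : ∀ k, -b < k → k ≤ a → run w (P k) = P (k + 1))
    (hl : run w (P (-b)) = M (-b + 1)) (hr : run w (P (a + 1)) = M (a + 1)) :
    ∃ v v', w = v ++ v' ∧ (v.length : ℤ) = 2 * a + 1 ∧
      (∀ k, 1 ≤ k → k ≤ a → run v (P k) = P k) ∧ run v (P (a + 1)) = M a := by
  have hneg : ∀ k, -b ≤ k → k < 0 → 2 ≤ chg w (P k) := by
    intro k h1 h2
    rcases h1.eq_or_lt with rfl | h1
    · have h3 := abs_cls_sub_le_chg w (P (-b))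
      rw [hl, cls_M, cls_P_of_nonpos (by omega)] at h3
      norm_num at h3
      exact_mod_cast h3
    -- The final position is shifted by one step, so the comparison is with the word x₀, whose pivot
    -- `P 0` is excluded.
    · refine two_le_chg_left (v := [.x]) h2.le (chg_singleton_eq_zero (P_injective.ne h2.ne))
        ?_ (P_strictMono.monotone h1.le) ?_
      · simp [hfix k h1 (by omega)]
      · rw [hl, run_cons, run_nil, x_act_P]
        exact (P_ne_M _ _).symm
  have hpos : ∀ k, 1 ≤ k → k < a + 1 → 2 ≤ chg w (P k) := by
    intro k h1 h2
    refine two_le_chg_right (v := [.x]) h1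
      (chg_singleton_eq_zero (P_injective.ne (show k ≠ 0 by omega))) ?_
      (P_strictMono.monotone h2.le) ?_
    · simp [hfix k (by omega) (by omega)]
    · rw [hr, run_cons, run_nil, x_act_P]
      exact (P_ne_M _ _).symm
  have hend : 1 ≤ chg w (P (a + 1)) := by
    refine one_le_chg_of_cls ?_
    rw [hr, cls_M, cls_P_of_pos (by omega)]
    norm_num
  have h0 : run w (P 0) = P 1 := hfix 0 (by omega) ha
  have hmid : 1 ≤ chg w (P 0) := by
    refine one_le_chg_of_cls ?_
    rw [h0, cls_P_of_pos le_rfl, cls_P_of_nonpos le_rfl]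
    norm_num
  -- A second change at `P 0` would force 2(a + b) + 3 letters, one more than allowed.
  have hmid' : chg w (P 0) = 1 := by
    by_contra hne
    have := le_length_of_chg (w := w) P_injective (l := -b) (u := a + 1) (by omega)
      (fun k h1 h2 => by
        rcases lt_trichotomy k 0 with h | rfl | h
        · exact hneg k h1 h
        · omega
        · exact hpos k h h2) hend
    omega
  obtain ⟨v, s, v', rfl, hv, hvs, hv'⟩ := exists_split hmid'
  have hs : s = .x := by
    have h1 := cls_run_of_chg_eq_zero hv
    rw [hvs, cls_P_of_nonpos le_rfl] at h1
    cases s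
    · rfl
    · rw [Letter.pivot, cls_P_of_pos le_rfl] at h1
      omega
    · rw [Letter.pivot, cls_M] at h1
      omega
    · rw [Letter.pivot, cls_P_of_pos le_rfl] at h1
      omega
  subst hs
  rw [Letter.act_pivot] at hv'
  change chg v' (P 1) = 0 at hv'
  change run v (P 0) = P 0 at hvs
  have hact : ∀ {t}, P 0 ≤ t → P 1 ≤ Letter.x.act (run v t) := by
    intro t ht
    have h1 := Letter.x.act_strictMono.monotone ((run_strictMono v).monotone ht)
    rwa [hvs, x_act_P] at h1
  -- Once `P 0` has crossed to `P 1` it keeps class 1, so nothing to its right changes class any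
  -- more; before the crossing, nothing to its left does.
  have hafter : ∀ k, 1 ≤ k → chg (v ++ .x :: v') (P k) = chg v (P k) := by
    intro k hk
    have hlt : P 0 < P k := P_strictMono (by omega)
    rw [chg_append, Nat.add_eq_left, chg_cons_eq_zero]
    refine ⟨fun h => ?_, (stay_right le_rfl hv' (hact hlt.le)).2⟩
    have h1 := run_strictMono v hlt
    rw [hvs, h] at h1
    exact lt_irrefl _ h1
  have hbefore : ∀ k ≤ 0, chg (v ++ .x :: v') (P k) = chg (.x :: v') (run v (P k)) := by
    intro k hk
    rw [chg_append, (stay_left le_rfl hv (P_strictMono.monotone hk)).2, zero_add]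
  -- The points on the right need 2a + 1 letters before the crossing, the others 2b + 1 from it on;
  -- together these exhaust the length, so `v` has exactly 2a + 1 letters.
  have len1 := le_length_of_chg (w := v) P_injective (l := 1) (u := a + 1) (by omega)
    (fun k h1 h2 => hafter k h1 ▸ hpos k h1 h2) (hafter (a + 1) (by omega) ▸ hend)
  have len2 := le_length_of_chg (w := .x :: v') (f := fun k => run v (P k))
    ((run_strictMono v).injective.comp P_injective) (l := -b) (u := 0) (by omega)
    (fun k h1 h2 => hbefore k h2.le ▸ hneg k h1 h2) (hbefore 0 le_rfl ▸ hmid)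
  rw [List.length_append] at hlen
  push_cast at hlen
  -- The rest `v'` is the identity from `P 1` on, so to the right of `P 0` the prefix can be read
  -- off from the whole word.
  have hrun : ∀ {t}, P 0 ≤ t → Letter.x.act (run v t) = run (v ++ .x :: v') t := by
    intro t ht
    have h1 : run v' (P 1) = P 1 := by
      rwa [run_append, hvs, run_cons, x_act_P] at h0
    have h2 := run_eq_run_right (w := v') (v := []) le_rfl hv' rfl h1 (hact ht)
    rw [run_append, run_cons, h2, run_nil]
  refine ⟨v, .x :: v', rfl, by omega, fun k h1 h2 => ?_, ?_⟩
  · refine Letter.x.act_strictMono.injective ?_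
    rw [hrun (P_strictMono.monotone (by omega)), hfix k (by omega) h2, x_act_P]
  · refine Letter.x.act_strictMono.injective ?_
    rw [hrun (P_strictMono.monotone (by omega)), hr, x_act_M]

/-- A short word for an element that lights two lamps and ends a step to the right of the middle
lights the left lamp first. -/
theorem exists_prefix_left {w : List Letter} {a b : ℤ} (ha : 1 ≤ a) (hb : 0 ≤ b)
    (hlen : (w.length : ℤ) ≤ 2 * (a + b) + 2)
    (hfix : ∀ k, -b < k → k ≤ a → run w (P k) = P (k - 1))
    (hl : run w (P (-b)) = M (-b - 1)) (hr : run w (P (a + 1)) = M (a - 1)) :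
    ∃ v v', w = v ++ v' ∧ (v.length : ℤ) = 2 * b + 2 ∧ ∀ t, P 1 ≤ t → run v t = t := by
  have hneg : ∀ k, -b ≤ k → k < 1 → 2 ≤ chg w (P k) := by
    intro k h1 h2
    rcases h1.eq_or_lt with rfl | h1
    · have h3 := abs_cls_sub_le_chg w (P (-b))
      rw [hl, cls_M, cls_P_of_nonpos (by omega)] at h3
      norm_num at h3
      exact_mod_cast h3
    · refine two_le_chg_left (v := [.X]) (by omega)
        (chg_singleton_eq_zero (P_injective.ne h2.ne)) ?_ (P_strictMono.monotone h1.le) ?_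
      · simp [hfix k h1 (by omega)]
      · rw [hl, run_cons, run_nil, X_act_P]
        exact (P_ne_M _ _).symm
  have hpos : ∀ k, 2 ≤ k → k < a + 1 → 2 ≤ chg w (P k) := by
    intro k h1 h2
    refine two_le_chg_right (v := [.X]) (by omega)
      (chg_singleton_eq_zero (P_injective.ne (show k ≠ 1 by omega))) ?_
      (P_strictMono.monotone h2.le) ?_
    · simp [hfix k (by omega) (by omega)]
    · rw [hr, run_cons, run_nil, X_act_P]
      exact (P_ne_M _ _).symm
  have hend : 1 ≤ chg w (P (a + 1)) := by
    refine one_le_chg_of_cls ?_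
    rw [hr, cls_M, cls_P_of_pos (by omega)]
    norm_num
  have h0 : run w (P 1) = P 0 := hfix 1 (by omega) ha
  have hmid : 1 ≤ chg w (P 1) := by
    refine one_le_chg_of_cls ?_
    rw [h0, cls_P_of_pos le_rfl, cls_P_of_nonpos le_rfl]
    norm_num
  have hmid' : chg w (P 1) = 1 := by
    by_contra hne
    have := le_length_of_chg (w := w) P_injective (l := -b) (u := a + 1) (by omega)
      (fun k h1 h2 => by
        rcases lt_trichotomy k 1 with h | rfl | h
        · exact hneg k h1 h
        · omega
        · exact hpos k h h2) hend
    omega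
  obtain ⟨v, s, v', rfl, hv, hvs, hv'⟩ := exists_split hmid'
  -- The class of `P 1` drops from 1 to 0 at this letter; `y` also lowers a class by 1, but its
  -- pivot has class 2.
  have hs : s = .X := by
    have h1 := cls_run_of_chg_eq_zero hv
    have h2 := cls_run_of_chg_eq_zero hv'
    rw [run_append, hvs, run_cons] at h0
    rw [h0, cls_act_pivot, ← hvs, h1, cls_P_of_pos le_rfl, cls_P_of_nonpos le_rfl] at h2
    rw [hvs, cls_P_of_pos le_rfl] at h1
    cases s <;> simp only [Letter.jump] at h2
    · omega
    · rfl
    · rw [Letter.pivot, cls_M] at h1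
      omega
    · omega
  subst hs
  rw [Letter.act_pivot] at hv'
  change chg v' (P 0) = 0 at hv'
  change run v (P 1) = P 1 at hvs
  have hafter : ∀ k, 2 ≤ k → chg (v ++ .X :: v') (P k) = chg v' (Letter.X.act (run v (P k))) := by
    intro k hk
    have hlt : P 1 < P k := P_strictMono (by omega)
    rw [chg_append, (stay_right le_rfl hv hlt.le).2, zero_add, chg_cons, if_neg, zero_add]
    intro h
    have h1 := run_strictMono v hlt
    rw [hvs, h] at h1
    exact lt_irrefl _ h1
  have hbefore : ∀ k < 1, chg (v ++ .X :: v') (P k) = chg v (P k) := by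
    intro k hk
    have h1 := run_strictMono v (P_strictMono hk)
    have h2 := Letter.X.act_strictMono h1
    rw [hvs, X_act_P] at h2
    rw [hvs] at h1
    rw [chg_append, Nat.add_eq_left, chg_cons_eq_zero]
    exact ⟨h1.ne, (stay_left le_rfl hv' h2.le).2⟩
  -- The left points need 2b + 2 letters before the crossing and the right ones 2a - 1 after it;
  -- with the crossing letter this is all there is.
  have len1 := two_mul_le_length (w := v) P_injective (l := -b) (u := 1)
    (fun k h1 h2 => hbefore k h2 ▸ hneg k h1 h2)
  have len2 := le_length_of_chg (w := v') (f := fun k => Letter.X.act (run v (P k)))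
    (Letter.X.act_strictMono.injective.comp ((run_strictMono v).injective.comp P_injective))
    (l := 2) (u := a + 1) (by omega) (fun k h1 h2 => hafter k h1 ▸ hpos k h1 h2)
    (hafter (a + 1) (by omega) ▸ hend)
  rw [List.length_append, List.length_cons] at hlen
  push_cast at hlen
  exact ⟨v, .X :: v', rfl, by omega, fun t ht =>
    run_eq_run_right (v := []) le_rfl hv rfl hvs ht⟩

/-! ### From words to elements of `F` and distances -/

/-- The generating set of Thompson's group `F`. -/
abbrev gens : Set ThompsonF := {x0, x1}

/-- The element of Thompson's group `F` given by a letter. -/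
noncomputable def Letter.toF : Letter → ThompsonF
  | .x => x0
  | .X => x0⁻¹
  | .y => x1
  | .Y => x1⁻¹

theorem Letter.toF_apply (s : Letter) (t : I) : ((s.toF.1.unop t : I) : ℝ) = s.act t := by
  cases s <;> rfl

theorem Letter.toF_mem (s : Letter) : s.toF ∈ gens ∨ s.toF⁻¹ ∈ gens := by
  cases s <;> simp [Letter.toF]

/-- The element of Thompson's group `F` given by a word. -/
noncomputable def eval (w : List Letter) : ThompsonF := (w.map Letter.toF).prod

theorem eval_append (v w : List Letter) : eval (v ++ w) = eval v * eval w := by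
  simp [eval]

theorem eval_cons (s : Letter) (w : List Letter) : eval (s :: w) = s.toF * eval w := by
  simp [eval]

@[simp] theorem eval_nil : eval [] = 1 := rfl

@[simp] theorem eval_replicate (n : ℕ) (s : Letter) :
    eval (List.replicate n s) = s.toF ^ n := by
  simp [eval]

theorem eval_singleton (s : Letter) : eval [s] = s.toF := by simp [eval]

theorem eval_apply (w : List Letter) (t : I) : ((eval w).1.unop t : ℝ) = run w t := by
  induction w generalizing t with
  | nil => rfl
  | cons s w ih => rw [eval_cons, mul_apply, ih, Letter.toF_apply, run_cons]

theorem run_eq_of_eval_eq {v w : List Letter} (h : eval v = eval w) {t : ℝ} (ht : t ∈ I) :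
    run v t = run w t := by
  rw [← eval_apply v ⟨t, ht⟩, h, eval_apply]

theorem eval_eq_of_run_eq {v w : List Letter} (h : ∀ t ∈ I, run v t = run w t) :
    eval v = eval w := by
  apply Subtype.ext
  apply MulOpposite.unop_injective
  refine Homeomorph.ext fun t => Subtype.ext ?_
  exact (eval_apply v t).trans ((h t t.2).trans (eval_apply w t).symm)

theorem P_mem (k : ℤ) : P k ∈ I := ⟨(P_pos k).le, (P_lt_one k).le⟩

theorem M_mem (k : ℤ) : M k ∈ I :=
  ⟨(P_pos k).le.trans (P_lt_M k).le, (M_lt_P k).le.trans (P_lt_one _).le⟩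

theorem AgreesWith.of_eval_eq {v w : List Letter} (h : eval v = eval w) : AgreesWith v w :=
  fun k => ⟨run_eq_of_eval_eq h (P_mem k), run_eq_of_eval_eq h (M_mem k)⟩

theorem exists_letters {l : List ThompsonF} (h : ∀ s ∈ l, s ∈ gens ∨ s⁻¹ ∈ gens) :
    ∃ w : List Letter, w.map Letter.toF = l := by
  induction l with
  | nil => exact ⟨[], rfl⟩
  | cons s l ih =>
    obtain ⟨w, rfl⟩ := ih fun t ht => h t (by simp [ht])
    have : ∃ a : Letter, a.toF = s := by
      rcases h s (by simp) with h | h <;> simp only [Set.mem_insert_iff, Set.mem_singleton_iff] at h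
      · rcases h with rfl | rfl
        exacts [⟨.x, rfl⟩, ⟨.y, rfl⟩]
      · rcases h with h | h
        · exact ⟨.X, inv_eq_iff_eq_inv.1 h ▸ rfl⟩
        · exact ⟨.Y, inv_eq_iff_eq_inv.1 h ▸ rfl⟩
    obtain ⟨a, rfl⟩ := this
    exact ⟨a :: w, rfl⟩

theorem edist_mul_eval_le (g : ThompsonF) (w : List Letter) :
    (SimpleGraph.mulCayley gens).edist g (g * eval w) ≤ w.length := by
  have := mulCayley_edist_prod_le (S := gens) g (w.map Letter.toF) (by
    intro s hs
    obtain ⟨a, -, rfl⟩ := List.mem_map.1 hs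
    exact a.toF_mem)
  rwa [List.length_map] at this

theorem exists_word_of_edist_le {g h : ThompsonF} {n : ℕ}
    (hn : (SimpleGraph.mulCayley gens).edist g h ≤ n) :
    ∃ w : List Letter, w.length ≤ n ∧ g * eval w = h := by
  obtain ⟨p, hp⟩ := SimpleGraph.exists_walk_of_edist_ne_top
    (ne_top_of_le_ne_top (ENat.natCast_ne_top n) hn)
  obtain ⟨l, h1, h2, h3⟩ := mulCayley_exists_word p
  obtain ⟨w, rfl⟩ := exists_letters h1
  refine ⟨w, ?_, h3⟩
  rw [← hp, Nat.cast_le] at hn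
  rw [← List.length_map, h2]
  exact hn

/-- A smaller distance would be realised by a shorter word with the same value. The bound is on
`edist` because `dist` is 0 between vertices not known to be connected. -/
theorem le_edist_mul_eval {g : ThompsonF} {z : List Letter} {n : ℕ}
    (h : ∀ w, AgreesWith w z → n ≤ w.length) :
    (n : ℕ∞) ≤ (SimpleGraph.mulCayley gens).edist g (g * eval z) := by
  by_contra hlt
  rw [not_le] at hlt
  obtain ⟨m, hm⟩ := ENat.ne_top_iff_exists.1 hlt.ne_top
  rw [← hm, Nat.cast_lt] at hlt
  obtain ⟨w, hw, hgw⟩ := exists_word_of_edist_le hm.ge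
  have := h w (.of_eval_eq (mul_left_cancel hgw))
  omega

/-! ### The commutation relation and the isometric loop -/

/-- Elements supported on the two sides of a point commute. -/
theorem commute_of_supports {v w : List Letter} {p : ℝ} (hv : ∀ t, p ≤ t → run v t = t)
    (hw : ∀ t, t ≤ p → run w t = t) : Commute (eval v) (eval w) := by
  rw [Commute, SemiconjBy, ← eval_append, ← eval_append]
  refine eval_eq_of_run_eq fun t _ => ?_
  rw [run_append, run_append]
  rcases le_total p t with h | h
  · have h1 := (run_strictMono w).monotone h
    rw [hw p le_rfl] at h1
    rw [hv t h, hv _ h1]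
  · have h1 := (run_strictMono v).monotone h
    rw [hv p le_rfl] at h1
    rw [hw t h, hw _ h1]

theorem run_replicate_x_X (n : ℕ) (t : ℝ) :
    run (List.replicate n .X) (run (List.replicate n .x) t) = t := by
  induction n generalizing t with
  | zero => rfl
  | succ n ih =>
    rw [List.replicate_succ' (a := Letter.x), List.replicate_succ, run_append, run_cons, run_cons,
      run_nil]
    exact (congrArg _ (Letter.act_inv_act .x _)).trans (ih t)

/-- The word `x₀ ^ n x₁ x₀ ^ -(n + 1)`. -/
def leftLampWord (n : ℕ) : List Letter :=
  List.replicate n .x ++ [.y] ++ List.replicate (n + 1) .X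

/-- From 3/4 on, x₁ coincides with x₀; since x₀ⁿ with n ≥ 1 carries [1/2, 1] there, x₀ⁿx₁ agrees
with x₀ⁿ⁺¹ on it. -/
theorem run_leftLampWord_of_ge {n : ℕ} (hn : 1 ≤ n) {t : ℝ} (ht : P 0 ≤ t) :
    run (leftLampWord n) t = t := by
  have h1 : 3 / 4 ≤ run (List.replicate n .x) t := by
    refine le_trans (P_ge (k := 0 + n) (by omega)) ?_
    rw [← run_replicate_x_P]
    exact (run_strictMono _).monotone ht
  have h2 : Letter.y.act (run (List.replicate n .x) t) = run (List.replicate (n + 1) .x) t := by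
    rw [List.replicate_succ', run_append]
    exact x1Fun_of_ge h1
  rw [leftLampWord, run_append, run_append, run_cons, run_nil, h2, run_replicate_x_X]

/-- The relation between `x₁` and its conjugates. -/
theorem commute_leftLampWord {n : ℕ} (hn : 1 ≤ n) : Commute (eval (leftLampWord n)) x1 := by
  have := commute_of_supports (w := [.y]) (p := P 0) (fun t ht => run_leftLampWord_of_ge hn ht)
    (fun t ht => x1Fun_of_le (by rwa [P_zero] at ht))
  rwa [eval_singleton] at this

theorem eval_leftLampWord (n : ℕ) : eval (leftLampWord n) = x0 ^ n * x1 * x0⁻¹ ^ (n + 1) := by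
  simp only [leftLampWord, eval_append, eval_replicate, eval_singleton, Letter.toF]

/-- The relator whose prefixes form an isometric loop. -/
def relator (n : ℕ) : List Letter :=
  List.replicate n .x ++ [.y] ++ List.replicate (n + 1) .X ++ [.Y] ++
    List.replicate (n + 1) .x ++ [.Y] ++ List.replicate n .X ++ [.y]

theorem length_relator (n : ℕ) : (relator n).length = 2 * (2 * n + 3) := by
  simp [relator]
  omega

/-- The relator is the commutator of the value of `leftLampWord n` with x₁⁻¹. -/
theorem eval_relator {n : ℕ} (hn : 1 ≤ n) : eval (relator n) = 1 := by
  have hc := commute_leftLampWord hn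
  have h1 : eval (relator n) =
      eval (leftLampWord n) * x1⁻¹ * (eval (leftLampWord n))⁻¹ * x1 := by
    rw [eval_leftLampWord]
    simp only [relator, eval_append, eval_replicate, eval_singleton, Letter.toF]
    group
  rw [h1, hc.inv_right.eq]
  group

/-- The antipodal pairs of the loop differ by elements of the greatest possible length. -/
theorem relator_window {n i : ℕ} (hn : 1 ≤ n) (hi : i < 2 * n + 3) :
    ∃ u z v : List Letter, relator n = u ++ z ++ v ∧ u.length = i ∧ z.length = 2 * n + 3 ∧
      ∀ w, AgreesWith w z → 2 * n + 3 ≤ w.length := by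
  -- The half starting at i begins in the first block of x₀, or right after the first x₁, or later,
  -- at or after the second letter of the block of x₀⁻¹; accordingly it contains x₁ and x₁⁻¹, one
  -- x₁⁻¹, or two.
  rcases lt_trichotomy i (n + 1) with h | rfl | h
  · obtain ⟨j, rfl⟩ := Nat.exists_eq_add_of_le (Nat.lt_succ_iff.1 h)
    refine ⟨List.replicate i .x, oppositeWord j i,
      List.replicate (j + 1) .x ++ [.Y] ++ List.replicate (i + j) .X ++ [.y], ?_, by simp, ?_,
      fun w hw => ?_⟩
    · have e1 : relator (i + j) = List.replicate (i + j) .x ++ [.y] ++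
          List.replicate (j + i + 1) .X ++ [.Y] ++ List.replicate (i + (j + 1)) .x ++ [.Y] ++
          List.replicate (i + j) .X ++ [.y] := by
        rw [relator, add_comm j i, add_assoc i j 1]
      rw [e1, oppositeWord, List.replicate_add i j Letter.x, List.replicate_add i (j + 1) Letter.x]
      simp only [List.append_assoc]
    · simp [oppositeWord]
      omega
    · have := hw.length_ge_oppositeWord
      omega
  · refine ⟨List.replicate n .x ++ [.y], lampWord (n + 1),
      [.Y] ++ List.replicate n .X ++ [.y], ?_, by simp, ?_, fun w hw => ?_⟩
    · simp only [relator, lampWord, List.append_assoc]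
    · simp [lampWord]
      omega
    · have := hw.length_ge_lampWord
      omega
  · obtain ⟨m, rfl⟩ := Nat.exists_eq_add_of_le (show n + 2 ≤ i by omega)
    obtain ⟨a, rfl⟩ := Nat.exists_eq_add_of_le (show m ≤ n by omega)
    refine ⟨List.replicate (m + a) .x ++ [.y] ++ List.replicate (m + 1) .X, sameWord a m,
      List.replicate a .X ++ [.y], ?_, ?_, ?_, fun w hw => ?_⟩
    · have e1 : relator (m + a) = List.replicate (m + a) .x ++ [.y] ++
          List.replicate (m + 1 + a) .X ++ [.Y] ++ List.replicate (a + m + 1) .x ++ [.Y] ++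
          List.replicate (m + a) .X ++ [.y] := by
        rw [relator, add_comm a m, add_right_comm m 1 a]
      rw [e1, sameWord, List.replicate_add (m + 1) a Letter.X, List.replicate_add m a Letter.X]
      simp only [List.append_assoc]
    · simp
      omega
    · simp [sameWord]
      omega
    · have := hw.length_ge_sameWord (by omega)
      omega

theorem isIsometricLoop_relator {n : ℕ} (hn : 1 ≤ n) :
    IsIsometricLoop (SimpleGraph.mulCayley gens) (2 * (2 * n + 3))
      (fun i => eval ((relator n).take i)) := by
  refine isIsometricLoop_of_antipodal (δ := fun i => eval ((relator n).take i)) (by omega) ?_ ?_ ?_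
  · intro i hi
    rw [← length_relator] at hi
    rw [List.take_add_one, List.getElem?_eq_getElem hi, eval_append]
    have := edist_mul_eval_le (eval ((relator n).take i)) [(relator n)[i]]
    simpa using this
  · rw [← length_relator, List.take_length, eval_relator hn, List.take_zero, eval_nil]
  · intro i hi
    obtain ⟨u, z, v, h1, h2, h3, h4⟩ := relator_window hn hi
    have e1 : (relator n).take i = u := by
      rw [h1, ← h2, List.append_assoc, List.take_left]
    have e2 : (relator n).take (i + (2 * n + 3)) = u ++ z := by
      rw [h1, ← h2, ← h3, ← List.length_append, List.take_left]
    rw [e1, e2, eval_append]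
    exact le_edist_mul_eval h4

/-! ### Failure of the fellow traveller property -/

theorem x0_ne_one : x0 ≠ 1 := by
  intro h
  have h1 : run [.x] (P 0) = run [] (P 0) :=
    run_eq_of_eval_eq (by rw [eval_singleton]; exact h) (P_mem 0)
  rw [run_cons, x_act_P, run_nil] at h1
  have := P_injective h1
  omega

theorem dist_mul_toF_eq_one (f : ThompsonF) {s : Letter} (hs : s.toF ≠ 1) :
    (SimpleGraph.mulCayley gens).dist f (f * s.toF) = 1 := by
  rw [SimpleGraph.dist_eq_one_iff_adj]
  have h1 := mulCayley_edist_mul_le s.toF_mem f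
  rw [SimpleGraph.edist_le_one_iff_adj_or_eq] at h1
  exact h1.resolve_right fun h => hs (mul_eq_left.1 h.symm)

theorem dist_one_eval_le (w : List Letter) :
    (SimpleGraph.mulCayley gens).dist 1 (eval w) ≤ w.length := by
  have h1 := edist_mul_eval_le 1 w
  rw [one_mul] at h1
  have h2 := ENat.toNat_le_toNat h1 (ENat.natCast_ne_top _)
  rwa [ENat.toNat_natCast] at h2

/-- The triangle inequality for `dist` requires connectedness; values of words are connected to 1,
so generation of the whole group is not needed. -/
theorem reachable_eval (v w : List Letter) :
    (SimpleGraph.mulCayley gens).Reachable (eval v) (eval w) := by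
  have : ∀ w, (SimpleGraph.mulCayley gens).Reachable 1 (eval w) := fun w => by
    have h1 := edist_mul_eval_le 1 w
    rw [one_mul] at h1
    exact SimpleGraph.reachable_of_edist_ne_top (ne_top_of_le_ne_top (ENat.natCast_ne_top _) h1)
  exact (this v).symm.trans (this w)

/-- Both lamps of the element of `sameWord` can be lit in either order. -/
theorem eval_sameWord_mul_inv {a : ℕ} (ha : 1 ≤ a) :
    eval (List.replicate (a + 1) .x ++ [.Y] ++ List.replicate (a + a) .X ++ [.Y] ++
      List.replicate (a - 1) .x) = eval (sameWord a a) * x0⁻¹ := by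
  obtain ⟨a, rfl⟩ := Nat.exists_eq_add_of_le' ha
  have hc := (commute_leftLampWord (n := a + 1 + (a + 1)) (by omega)).inv_inv.eq
  rw [eval_leftLampWord] at hc
  simp only [sameWord, eval_append, eval_replicate, eval_singleton, Letter.toF,
    Nat.add_sub_cancel]
  -- Up to these outer powers of x₀, the two words are the two products of the commuting elements in
  -- either order.
  have h1 := congrArg (fun g => x0⁻¹ ^ (a + 1) * g * x0 ^ a) hc
  calc _ = _ := by group
    _ = _ := h1
    _ = _ := by group

/-- The element of `sameWord a a` has neighbours one step to either side whose geodesics from the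
identity diverge: those to one neighbour light the right lamp first, those to the other the left. -/
theorem not_hasFellowTravellerProperty {c : ThompsonF → List ThompsonF}
    (hc : IsGeodesicCombing gens c) : ¬ HasFellowTravellerProperty gens c := by
  rintro ⟨k, hk⟩
  -- Smallest value for which 2a ≤ 2k + 1, the outcome of the final count, is false.
  set a := k + 1 with ha
  set f := eval (sameWord a a) with hf
  have lift : ∀ g, ∃ w : List Letter, w.map Letter.toF = c g ∧ eval w = g := by
    intro g
    obtain ⟨w, hw⟩ := exists_letters (hc.letters g)
    exact ⟨w, hw, by rw [eval, hw, hc.prod_eq]⟩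
  have len : ∀ {g : ThompsonF} {w z : List Letter}, w.map Letter.toF = c g → eval z = g →
      w.length ≤ z.length := by
    intro g w z hw hz
    rw [← List.length_map (f := Letter.toF), hw, hc.geodesic, ← hz]
    exact dist_one_eval_le z
  obtain ⟨wf, hwf, -⟩ := lift f
  obtain ⟨wg, hwg, hg⟩ := lift (f * x0)
  obtain ⟨wh, hwh, hh⟩ := lift (f * x0⁻¹)
  -- Multiplication by x₀ or x₀⁻¹ shortens one of the two words for f at its end, so both neighbours
  -- have words of 4a + 2 letters.
  have leng := len hwg (z := List.replicate a .X ++ [.Y] ++ List.replicate (a + a + 1) .x ++ [.Y] ++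
    List.replicate (a - 1) .X) (by
      rw [hf, ha, Nat.add_sub_cancel]
      simp only [sameWord, eval_append, eval_replicate, eval_singleton, Letter.toF]
      group)
  have lenh := len hwh (eval_sameWord_mul_inv (by omega))
  simp only [List.length_append, List.length_replicate, List.length_singleton] at leng lenh
  have rg : ∀ t ∈ I, run wg t = Letter.x.act (run (sameWord a a) t) := by
    intro t ht
    rw [run_eq_of_eval_eq (w := sameWord a a ++ [.x]) (by
      rw [hg, eval_append, eval_singleton]; rfl) ht, run_append]
    rfl
  have rh : ∀ t ∈ I, run wh t = Letter.X.act (run (sameWord a a) t) := by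
    intro t ht
    rw [run_eq_of_eval_eq (w := sameWord a a ++ [.X]) (by
      rw [hh, eval_append, eval_singleton]; rfl) ht, run_append]
    rfl
  obtain ⟨v, v', rfl, hvl, hvfix, hvend⟩ := exists_prefix_right (w := wg) (a := a) (b := a)
    (by omega) (by omega) (by omega)
    (fun k h1 h2 => by rw [rg _ (P_mem _), run_sameWord_fix h1 h2, x_act_P])
    (by rw [rg _ (P_mem _), run_sameWord_left, x_act_M])
    (by rw [rg _ (P_mem _), run_sameWord_right (by omega), x_act_M])
  obtain ⟨u, u', rfl, hul, hufix⟩ := exists_prefix_left (w := wh) (a := a) (b := a)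
    (by omega) (by omega) (by omega)
    (fun k h1 h2 => by rw [rh _ (P_mem _), run_sameWord_fix h1 h2, X_act_P])
    (by rw [rh _ (P_mem _), run_sameWord_left, X_act_M])
    (by rw [rh _ (P_mem _), run_sameWord_right (by omega), X_act_M])
  -- The prefix `u` is one letter longer than `v`; its last letter is split off to compare both
  -- paths at time 2a + 1.
  obtain ⟨u₁, s, rfl⟩ : ∃ u₁ s, u = u₁ ++ [s] := by
    rcases List.eq_nil_or_concat u with rfl | ⟨u₁, s, h⟩
    · simp at hul
      omega
    · exact ⟨u₁, s, by simpa using h⟩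
  have hvl' : v.length = 2 * a + 1 := by omega
  have hul' : u₁.length = 2 * a + 1 := by
    rw [List.length_append, List.length_singleton] at hul
    omega
  have tg : ((c (f * x0)).take (2 * a + 1)).prod = eval v := by
    rw [← hwg, ← List.map_take, ← hvl', List.take_left, eval]
  have th : ((c (f * x0⁻¹)).take (2 * a + 1)).prod = eval u₁ := by
    rw [← hwh, ← List.map_take, ← hul', List.append_assoc, List.take_left, eval]
  have tf : ((c f).take (2 * a + 1)).prod = eval (wf.take (2 * a + 1)) := by
    rw [← hwf, ← List.map_take, eval]
  have d1 := hk f (f * x0) (dist_mul_toF_eq_one f (s := .x) x0_ne_one) (2 * a + 1)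
  have d2 := hk f (f * x0⁻¹) (dist_mul_toF_eq_one f (s := .X) (inv_ne_one.2 x0_ne_one))
    (2 * a + 1)
  rw [tg, tf, SimpleGraph.dist_comm] at d1
  rw [th, tf] at d2
  have d3 := (reachable_eval v (wf.take (2 * a + 1))).dist_triangle_left (eval u₁)
  obtain ⟨z, hz, hvz⟩ := exists_word_of_edist_le (g := eval v) (h := eval u₁) (n := 2 * k) (by
    rw [← (reachable_eval v u₁).coe_dist_eq_edist, Nat.cast_le]
    omega)
  have hrun : ∀ t ∈ I, run (z ++ [s]) (run v t) = run (u₁ ++ [s]) t := by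
    intro t ht
    rw [← run_append]
    refine run_eq_of_eval_eq ?_ ht
    rw [← List.append_assoc, eval_append, eval_append, hvz, eval_append]
  have hzP : ∀ k : ℤ, 1 ≤ k → k ≤ a → run (z ++ [s]) (P k) = P k := by
    intro k h1 h2
    have h3 := hrun (P k) (P_mem k)
    rwa [hvfix k h1 h2, hufix _ (P_strictMono.monotone h1)] at h3
  have hzM : run (z ++ [s]) (M a) = P (a + 1) := by
    have h3 := hrun (P (a + 1)) (P_mem _)
    rwa [hvend, hufix _ (P_strictMono.monotone (by omega))] at h3
  -- The word leading from `v` to `u` extinguishes the right lamp while fixing `P 1`, …, `P a`, so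
  -- it has at least 2a letters.
  have := two_mul_le_length (w := z ++ [s]) P_injective (l := 1) (u := a + 1) (fun k h1 h2 => by
    refine two_le_chg_right (v := []) h1 rfl (hzP k h1 (by omega))
      ((P_strictMono.monotone (show k ≤ a by omega)).trans (P_lt_M _).le) ?_
    rw [hzM]
    exact P_ne_M _ _)
  rw [List.length_append, List.length_singleton] at this
  push_cast at this
  omega

end ThompsonF

theorem corollary6p4p2 :
    (∀ N : ℕ, ∃ n ≥ N, ∃ γ : Fin n → ThompsonF,
      IsIsometricLoop (SimpleGraph.mulCayley {ThompsonF.x0, ThompsonF.x1}) n γ) ∧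
    ∀ c : ThompsonF → List ThompsonF,
      IsGeodesicCombing {ThompsonF.x0, ThompsonF.x1} c →
        ¬ HasFellowTravellerProperty {ThompsonF.x0, ThompsonF.x1} c :=
  ⟨fun N => ⟨_, by omega, _, ThompsonF.isIsometricLoop_relator (n := N + 1) (by omega)⟩,
    fun _ hc => ThompsonF.not_hasFellowTravellerProperty hc⟩
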